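/- Let $G$ be a finite abelian group. For a finite group $H$ let $A(H)$ be its Burnside ring, and for $I\le H$ and $p$ prime or $0$ let $\varphi^I_{H,p}\colon A(H)\to\mathbb Z/p\mathbb Z$ be the ring homomorphism sending a finite $H$-set $X$ to $|X^I|$ modulo $p$ (with $\mathbb Z/0=\mathbb Z$). Let $\underline A_G$ be the Burnside Tambara functor of $G$: $\underline A_G(G/H)=A(H)$ for $H\le G$, with restriction, transfer ($X\mapsto H\times_K X$), norm ($X\mapsto \mathrm{Map}_K(H,X)$, extended to formal differences as the unique algebraic, i.e. polynomial, map) and conjugation. An ideal of $\underline A_G$ is a family of ideals $\mathscr I(G/H)\subseteq A(H)$ closed under restriction, transfer and conjugation and such that the norm from $K$ to $H$ maps $\mathscr I(G/K)$ into $\mathscr I(G/H)+N_K^H(0)$. A proper ideal $\mathscr P$ is prime if $\mathscr I\mathscr J\subseteq\mathscr P$ implies $\mathscr I\subseteq\mathscr P$ or $\mathscr J\subseteq\mathscr P$, where $\mathscr I\mathscr J(G/H)$ is the set of all finite sums of transfers to $H$ of products $ab$ with $a\in\mathscr I(G/K)$, $b\in\mathscr J(G/K)$, $K\le H$. $\operatorname{Spec}(\underline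 A_G)$ is the set of prime ideals, with closed sets $V(\mathscr I)=\{\mathscr P\mid \mathscr I\subseteq\mathscr P\}$. For $C\le G$ and $p$ prime or $0$, let $$\mathfrak p_{C,p}(G/H)=\bigcap_{I\le H\cap C}\ker\varphi^I_{H,p}\qquad(H\le G).$$ Then: 1. Each $\mathfrak p_{C,p}$ is a prime ideal of $\underline A_G$. Put $S=\{\mathfrak p_{C,p}\mid C\le G,\ p\text{ prime or }0\}\subseteq\operatorname{Spec}(\underline A_G)$, with the subspace topology. 2. There is a bijection $\operatorname{Spec}(A(G))\leftrightarrow S$ with $\ker\varphi^C_{G,p}\leftrightarrow\mathfrak p_{C,p}$ for all $C\le G$ and all $p$ prime or $0$. 3. If $G$ is nontrivial, then $\operatorname{Spec}(A(G))$ and $S$ are not homeomorphic. 4. The Krull dimension (the supremum of the lengths of strict chains of primes) of $\operatorname{Spec}(A(G))$ is $1$, and that of $S$ is $m+1$, where $m$ is the maximal length of a strict chain of subgroups of $G$. -/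

import Mathlib

universe u v

namespace BurnsideTambara

noncomputable section

theorem grothendieckAddGroup_exists_eq_sub {M : Type u} [AddCommMonoid M]
    (x : Algebra.GrothendieckAddGroup M) :
    ∃ s t : M, x = Algebra.GrothendieckAddGroup.of s - Algebra.GrothendieckAddGroup.of t := by
  induction x using AddLocalization.ind with
  | _ y =>
    obtain ⟨s, t, ht⟩ := y
    refine ⟨s, t, ?_⟩
    rw [eq_sub_iff_add_eq, AddLocalization.mk_eq_addMonoidOf_mk']
    exact AddSubmonoid.LocalizationMap.mk'_spec _ s ⟨t, ht⟩

/-- The iterated difference `Δ_{y₁} ⋯ Δ_{yₙ} f`, where `Δ_y f (x) = f (x + y) - f x`. -/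
def iterDiff {M : Type u} {B : Type v} [AddCommMonoid M] [AddCommGroup B] (l : List M)
    (f : M → B) : M → B :=
  l.foldr (fun y g => fwdDiff y g) f

/-- A map from a commutative monoid to an abelian group is algebraic (polynomial) if all its
iterated differences of some order vanish. -/
def IsAlgebraicMap {M : Type u} {B : Type v} [AddCommMonoid M] [AddCommGroup B] (f : M → B) :
    Prop :=
  ∃ n : ℕ, ∀ l : List M, l.length = n → iterDiff l f = 0

/-- Translation operators on functions. -/
def shiftHom (M : Type u) (B : Type v) [AddCommMonoid M] [AddCommGroup B] :
    Multiplicative M →* Module.End ℤ (M → B) where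
  toFun m :=
    { toFun := fun g x => g (x + m.toAdd)
      map_add' := fun _ _ => rfl
      map_smul' := fun _ _ => rfl }
  map_one' := by
    ext g x
    simp
  map_mul' a b := by
    ext g x
    simp [add_assoc]

/-- A map from a monoid to an abelian group that is algebraic extends to an algebraic map on the
Grothendieck group. -/
theorem IsAlgebraicMap.exists_extension {M : Type u} {B : Type v} [AddCommMonoid M]
    [AddCommGroup B] {f : M → B} (hf : IsAlgebraicMap f) :
    ∃ F : Algebra.GrothendieckAddGroup M → B, IsAlgebraicMap F ∧
      ∀ m, F (Algebra.GrothendieckAddGroup.of m) = f m := by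
  obtain ⟨n, hn⟩ := hf
  let Φ : AddMonoidAlgebra ℤ M →ₐ[ℤ] Module.End ℤ (M → B) :=
    AddMonoidAlgebra.lift ℤ _ M (shiftHom M B)
  have hΦ : ∀ (m : M) (g : M → B) (x : M), Φ (AddMonoidAlgebra.single m 1) g x = g (x + m) := by
    intro m g x
    simp [Φ, shiftHom]
  let J : Ideal (AddMonoidAlgebra ℤ M) :=
    { carrier := {r | Φ r f = 0}
      add_mem' := fun {a b} ha hb => by
        simp only [Set.mem_ofPred_eq] at ha hb ⊢
        rw [map_add, LinearMap.add_apply, ha, hb, add_zero]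
      zero_mem' := by simp
      smul_mem' := fun c r hr => by
        simp only [Set.mem_ofPred_eq, smul_eq_mul] at hr ⊢
        rw [map_mul, Module.End.mul_apply, hr, map_zero] }
  have hJ : ∀ r, r ∈ J ↔ Φ r f = 0 := fun _ => Iff.rfl
  have hprod : ∀ l : List M,
      Φ ((l.map fun m => AddMonoidAlgebra.single m (1 : ℤ) - 1).prod) f = iterDiff l f := by
    intro l
    induction l with
    | nil => simp [iterDiff]
    | cons m l ih =>
      rw [List.map_cons, List.prod_cons, map_mul, Module.End.mul_apply, ih, map_sub, map_one]
      funext x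
      simp only [LinearMap.sub_apply, Pi.sub_apply, hΦ, Module.End.one_apply, iterDiff,
        List.foldr_cons, fwdDiff]
  let π := Ideal.Quotient.mk J
  let uh : Multiplicative M →* (AddMonoidAlgebra ℤ M ⧸ J) :=
    (π : AddMonoidAlgebra ℤ M →* (AddMonoidAlgebra ℤ M ⧸ J)).comp (AddMonoidAlgebra.of ℤ M)
  have huh : ∀ m : M, uh (Multiplicative.ofAdd m) = π (AddMonoidAlgebra.single m 1) :=
    fun _ => rfl
  have hzero : ∀ l : List M, l.length = n →
      (l.map fun m => uh (Multiplicative.ofAdd m) - 1).prod = 0 := by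
    intro l hl
    have h1 : π ((l.map fun m => AddMonoidAlgebra.single m (1 : ℤ) - 1).prod) = 0 := by
      rw [Ideal.Quotient.eq_zero_iff_mem, hJ, hprod, hn l hl]
    rw [map_list_prod, List.map_map] at h1
    rw [← h1]
    congr 2
  have hunit : ∀ m, IsUnit (uh m) := by
    intro m
    have h1 : IsNilpotent (uh m - 1) := by
      refine ⟨n, ?_⟩
      have := hzero (List.replicate n m.toAdd) (List.length_replicate)
      simpa using this
    simpa using h1.isUnit_add_one
  let ι : Algebra.GrothendieckAddGroup M →+ Additive (AddMonoidAlgebra ℤ M ⧸ J)ˣ :=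
    Algebra.GrothendieckAddGroup.lift (M := M) (G := Additive (AddMonoidAlgebra ℤ M ⧸ J)ˣ)
      (MonoidHom.toAdditiveRight (IsUnit.liftRight uh hunit))
  let ε : Algebra.GrothendieckAddGroup M → (AddMonoidAlgebra ℤ M ⧸ J) :=
    fun a => ((ι a).toMul : (AddMonoidAlgebra ℤ M ⧸ J)ˣ)
  have hε_add : ∀ a b, ε (a + b) = ε a * ε b := fun a b => by simp [ε]
  have hε_of : ∀ m, ε (Algebra.GrothendieckAddGroup.of m) = uh (Multiplicative.ofAdd m) := by
    intro m
    have : ι (Algebra.GrothendieckAddGroup.of m) =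
        MonoidHom.toAdditiveRight (IsUnit.liftRight uh hunit) m :=
      DFunLike.congr_fun ((Algebra.GrothendieckAddGroup.lift
        (M := M) (G := Additive (AddMonoidAlgebra ℤ M ⧸ J)ˣ)).symm_apply_apply
        (MonoidHom.toAdditiveRight (IsUnit.liftRight uh hunit))) m
    simp only [ε, this]
    rfl
  let ev : (AddMonoidAlgebra ℤ M ⧸ J) → B := fun q => Φ (Quotient.out q) f 0
  have hev : ∀ r, ev (π r) = Φ r f 0 := by
    intro r
    have h1 : π (Quotient.out (π r)) = π r := Quotient.out_eq _
    have h2 : Φ (Quotient.out (π r) - r) f = 0 := by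
      rw [← hJ, ← Ideal.Quotient.eq]
      exact h1
    rw [map_sub, LinearMap.sub_apply, sub_eq_zero] at h2
    exact congrFun h2 0
  have hev_sub : ∀ p q, ev (p - q) = ev p - ev q := by
    intro p q
    obtain ⟨a, rfl⟩ := Ideal.Quotient.mk_surjective p
    obtain ⟨b, rfl⟩ := Ideal.Quotient.mk_surjective q
    change ev (π a - π b) = ev (π a) - ev (π b)
    rw [← map_sub, hev, hev, hev]
    simp
  have hdiff : ∀ (l : List (Algebra.GrothendieckAddGroup M)) (x : Algebra.GrothendieckAddGroup M),
      iterDiff l (fun a => ev (ε a)) x = ev (ε x * (l.map fun a => ε a - 1).prod) := by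
    intro l
    induction l with
    | nil => intro x; simp [iterDiff]
    | cons a l ih =>
      intro x
      change iterDiff l (fun a => ev (ε a)) (x + a) - iterDiff l (fun a => ev (ε a)) x = _
      rw [ih, ih, ← hev_sub, hε_add, List.map_cons, List.prod_cons]
      congr 1
      ring
  let S : Set (AddMonoidAlgebra ℤ M ⧸ J) := Set.range fun m : M => uh (Multiplicative.ofAdd m) - 1
  have hS : Ideal.span S ^ n = ⊥ := by
    rw [Ideal.span, Submodule.span_pow, Submodule.span_eq_bot]
    intro x hx
    obtain ⟨g, rfl⟩ := Set.mem_pow.mp hx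
    choose m hm using fun i => (g i).2
    rw [← hzero (List.ofFn m) (List.length_ofFn), List.map_ofFn]
    congr 2
    funext i
    exact (hm i).symm
  have hεS : ∀ a, ε a - 1 ∈ Ideal.span S := by
    intro a
    obtain ⟨s, t, rfl⟩ := grothendieckAddGroup_exists_eq_sub a
    have h0 : ε (0 : Algebra.GrothendieckAddGroup M) = 1 := by simp [ε]
    have h1 : ε (Algebra.GrothendieckAddGroup.of t) * ε (-Algebra.GrothendieckAddGroup.of t) = 1 := by
      rw [← hε_add, add_neg_cancel, h0]
    have hs : ∀ m : M, ε (Algebra.GrothendieckAddGroup.of m) - 1 ∈ Ideal.span S :=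
      fun m => Ideal.subset_span ⟨m, by rw [hε_of]⟩
    have h2 : ε (Algebra.GrothendieckAddGroup.of s - Algebra.GrothendieckAddGroup.of t) - 1 =
        ε (-Algebra.GrothendieckAddGroup.of t) * ((ε (Algebra.GrothendieckAddGroup.of s) - 1)
          - (ε (Algebra.GrothendieckAddGroup.of t) - 1)) := by
      rw [sub_eq_add_neg (Algebra.GrothendieckAddGroup.of s), hε_add]
      linear_combination h1
    rw [h2]
    exact Ideal.mul_mem_left _ _ (Ideal.sub_mem _ (hs s) (hs t))
  have hmem : ∀ l : List (Algebra.GrothendieckAddGroup M),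
      (l.map fun a => ε a - 1).prod ∈ Ideal.span S ^ l.length := by
    intro l
    induction l with
    | nil => simp
    | cons a l ih =>
      rw [List.map_cons, List.prod_cons, List.length_cons]
      rw [Submodule.pow_succ, mul_comm]
      exact Submodule.mul_mem_mul ih (hεS a)
  refine ⟨fun a => ev (ε a), ⟨n, fun l hl => ?_⟩, fun m => ?_⟩
  · funext x
    have h1 := hmem l
    rw [hl, hS, Ideal.mem_bot] at h1
    rw [hdiff, h1, mul_zero, ← map_zero π, hev]
    simp
  · change ev (ε _) = f m
    rw [hε_of, huh, hev, hΦ, zero_add]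

theorem iterDiff_sub {M : Type u} {B : Type v} [AddCommMonoid M] [AddCommGroup B] (l : List M)
    (f g : M → B) : iterDiff l (f - g) = iterDiff l f - iterDiff l g := by
  induction l with
  | nil => rfl
  | cons a l ih =>
    change fwdDiff a (iterDiff l (f - g)) = fwdDiff a (iterDiff l f) - fwdDiff a (iterDiff l g)
    rw [ih]
    funext x
    simp only [fwdDiff, Pi.sub_apply]
    abel

theorem IsAlgebraicMap.extension_unique {M : Type u} {B : Type v} [AddCommMonoid M]
    [AddCommGroup B] {F F' : Algebra.GrothendieckAddGroup M → B} (hF : IsAlgebraicMap F)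
    (hF' : IsAlgebraicMap F')
    (h : ∀ m, F (Algebra.GrothendieckAddGroup.of m) = F' (Algebra.GrothendieckAddGroup.of m)) :
    F = F' := by
  have key : ∀ (n : ℕ) (u : Algebra.GrothendieckAddGroup M → B),
      (∀ l : List (Algebra.GrothendieckAddGroup M), l.length = n → iterDiff l u = 0) →
      (∀ m, u (Algebra.GrothendieckAddGroup.of m) = 0) → u = 0 := by
    intro n
    induction n with
    | zero => exact fun u hu _ => hu [] rfl
    | succ n ih =>
      intro u hu h0
      have hd : ∀ t : M, fwdDiff (Algebra.GrothendieckAddGroup.of t) u = 0 := by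
        intro t
        refine ih _ (fun l hl => ?_) fun m => ?_
        · have := hu (l ++ [Algebra.GrothendieckAddGroup.of t]) (by simp [hl])
          simpa [iterDiff] using this
        · rw [fwdDiff, ← map_add, h0, h0, sub_zero]
      funext x
      obtain ⟨s, t, rfl⟩ := grothendieckAddGroup_exists_eq_sub x
      have h1 := congrFun (hd t) (Algebra.GrothendieckAddGroup.of s - Algebra.GrothendieckAddGroup.of t)
      rw [fwdDiff, sub_add_cancel, h0] at h1
      simpa using h1
  obtain ⟨n, hn⟩ := hF
  obtain ⟨m, hm⟩ := hF'
  have hlong : ∀ (k : ℕ) (u : Algebra.GrothendieckAddGroup M → B),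
      (∀ l : List (Algebra.GrothendieckAddGroup M), l.length = k → iterDiff l u = 0) →
      ∀ l : List (Algebra.GrothendieckAddGroup M), k ≤ l.length → iterDiff l u = 0 := by
    intro k u hu l
    induction l with
    | nil => exact fun hk => hu [] (by simpa using hk.antisymm (Nat.zero_le _) |>.symm)
    | cons a l ih =>
      intro hk
      rcases hk.eq_or_lt with h1 | h1
      · exact hu _ h1.symm
      · change fwdDiff a (iterDiff l u) = 0
        rw [ih (by simpa [Nat.lt_succ_iff] using h1)]
        funext x
        simp [fwdDiff]
  refine sub_eq_zero.mp (key (max n m) (F - F') (fun l hl => ?_) fun t => ?_)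
  · rw [iterDiff_sub, hlong n F hn l (by omega), hlong m F' hm l (by omega), sub_zero]
  · rw [Pi.sub_apply, h, sub_self]

/-- The Grothendieck ring of a commutative semiring `S`: formal differences of elements of `S`. -/
def GrothendieckRing (S : Type u) [CommSemiring S] : Type u := Algebra.GrothendieckAddGroup S

namespace GrothendieckRing

instance instAddCommGroup (S : Type u) [CommSemiring S] : AddCommGroup (GrothendieckRing S) :=
  inferInstanceAs (AddCommGroup (Algebra.GrothendieckAddGroup S))

/-- The canonical map as an additive homomorphism. -/
def ofAdd (S : Type u) [CommSemiring S] : S →+ GrothendieckRing S :=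
  Algebra.GrothendieckAddGroup.of

/-- The universal property of the underlying additive group. -/
def liftAdd {S : Type u} [CommSemiring S] {B : Type v} [AddCommGroup B] (f : S →+ B) :
    GrothendieckRing S →+ B :=
  Algebra.GrothendieckAddGroup.lift f

theorem liftAdd_ofAdd {S : Type u} [CommSemiring S] {B : Type v} [AddCommGroup B] (f : S →+ B)
    (s : S) : liftAdd f (ofAdd S s) = f s :=
  DFunLike.congr_fun (Algebra.GrothendieckAddGroup.lift.symm_apply_apply f) s

theorem exists_eq_sub {S : Type u} [CommSemiring S] (x : GrothendieckRing S) :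
    ∃ s t : S, x = ofAdd S s - ofAdd S t :=
  grothendieckAddGroup_exists_eq_sub x

/-- The multiplication, extended biadditively from `S`. -/
def mulHom (S : Type u) [CommSemiring S] :
    GrothendieckRing S →+ GrothendieckRing S →+ GrothendieckRing S :=
  liftAdd
    { toFun := fun s => liftAdd ((ofAdd S).comp (AddMonoidHom.mulLeft s))
      map_zero' := by
        ext x
        obtain ⟨a, b, rfl⟩ := exists_eq_sub x
        simp [liftAdd_ofAdd]
      map_add' := fun s t => by
        ext x
        obtain ⟨a, b, rfl⟩ := exists_eq_sub x
        simp only [map_sub, liftAdd_ofAdd, AddMonoidHom.add_apply, AddMonoidHom.comp_apply,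
          AddMonoidHom.coe_mulLeft, add_mul, map_add] }

theorem mulHom_of (S : Type u) [CommSemiring S] (s t : S) :
    mulHom S (ofAdd S s) (ofAdd S t) = ofAdd S (s * t) := by
  simp [mulHom, liftAdd_ofAdd]

instance instMul (S : Type u) [CommSemiring S] : Mul (GrothendieckRing S) :=
  ⟨fun x y => mulHom S x y⟩

instance instOne (S : Type u) [CommSemiring S] : One (GrothendieckRing S) := ⟨ofAdd S 1⟩

theorem ofAdd_mul (S : Type u) [CommSemiring S] (s t : S) :
    ofAdd S (s * t) = ofAdd S s * ofAdd S t := (mulHom_of S s t).symm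

theorem sub_mul_sub' (S : Type u) [CommSemiring S] (a b c d : S) :
    (ofAdd S a - ofAdd S b) * (ofAdd S c - ofAdd S d) =
      ofAdd S (a * c + b * d) - ofAdd S (a * d + b * c) := by
  change mulHom S _ _ = _
  simp only [map_sub, AddMonoidHom.sub_apply, mulHom_of, map_add]
  abel

instance instCommRing (S : Type u) [CommSemiring S] : CommRing (GrothendieckRing S) :=
  { instAddCommGroup S, instMul S, instOne S with
    left_distrib := fun a b c => map_add (mulHom S a) b c
    right_distrib := fun a b c => by
      change mulHom S (a + b) c = mulHom S a c + mulHom S b c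
      rw [map_add, AddMonoidHom.add_apply]
    zero_mul := fun a => by
      change mulHom S 0 a = 0
      rw [map_zero, AddMonoidHom.zero_apply]
    mul_zero := fun a => map_zero (mulHom S a)
    mul_assoc := fun x y z => by
      obtain ⟨a, b, rfl⟩ := exists_eq_sub x
      obtain ⟨c, d, rfl⟩ := exists_eq_sub y
      obtain ⟨e, f, rfl⟩ := exists_eq_sub z
      simp only [sub_mul_sub']
      congr 2 <;> ring
    mul_comm := fun x y => by
      obtain ⟨a, b, rfl⟩ := exists_eq_sub x
      obtain ⟨c, d, rfl⟩ := exists_eq_sub y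
      simp only [sub_mul_sub']
      congr 2 <;> ring
    one_mul := fun x => by
      obtain ⟨a, b, rfl⟩ := exists_eq_sub x
      change mulHom S (ofAdd S 1) _ = _
      simp [mulHom_of]
    mul_one := fun x => by
      obtain ⟨a, b, rfl⟩ := exists_eq_sub x
      change mulHom S _ (ofAdd S 1) = _
      simp [mulHom_of] }

/-- The canonical ring homomorphism from a semiring to its Grothendieck ring. -/
def of (S : Type u) [CommSemiring S] : S →+* GrothendieckRing S :=
  { ofAdd S with
    map_one' := rfl
    map_mul' := ofAdd_mul S }

/-- The universal property: a homomorphism to a ring extends to the Grothendieck ring. -/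
def lift {S : Type u} [CommSemiring S] {R : Type v} [CommRing R] (f : S →+* R) :
    GrothendieckRing S →+* R :=
  { liftAdd f.toAddMonoidHom with
    map_one' := (liftAdd_ofAdd _ 1).trans (map_one f)
    map_mul' := fun x y => by
      obtain ⟨a, b, rfl⟩ := exists_eq_sub x
      obtain ⟨c, d, rfl⟩ := exists_eq_sub y
      rw [sub_mul_sub']
      change liftAdd f.toAddMonoidHom _
        = liftAdd f.toAddMonoidHom _ * liftAdd f.toAddMonoidHom _
      simp only [map_sub, liftAdd_ofAdd, RingHom.toAddMonoidHom_eq_coe, AddMonoidHom.coe_coe,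
        map_add, map_mul]
      ring }

theorem lift_of {S : Type u} [CommSemiring S] {R : Type v} [CommRing R] (f : S →+* R) (s : S) :
    lift f (of S s) = f s := liftAdd_ofAdd _ s

end GrothendieckRing

/-- A finite set with an action of `H`. -/
structure FinGSet (H : Type u) [Group H] : Type (u + 1) where
  carrier : Type u
  [finite : Finite carrier]
  [action : MulAction H carrier]

attribute [instance] FinGSet.finite FinGSet.action

/-- Isomorphism of finite `H`-sets: an equivariant bijection. -/
def FinGSet.Iso {H : Type u} [Group H] (X Y : FinGSet H) : Prop :=
  ∃ e : X.carrier ≃ Y.carrier, ∀ (h : H) (x : X.carrier), e (h • x) = h • e x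

theorem FinGSet.Iso.of_bijective {H : Type u} [Group H] {X Y : FinGSet H}
    (f : X.carrier → Y.carrier) (hf : Function.Bijective f)
    (h_eq : ∀ (h : H) (x : X.carrier), f (h • x) = h • f x) : X.Iso Y :=
  ⟨Equiv.ofBijective f hf, h_eq⟩

instance FinGSet.setoid (H : Type u) [Group H] : Setoid (FinGSet H) where
  r := FinGSet.Iso
  iseqv :=
    { refl := fun _ => ⟨Equiv.refl _, fun _ _ => rfl⟩
      symm := fun ⟨e, he⟩ => ⟨e.symm, fun h y => by
        rw [Equiv.symm_apply_eq, he, Equiv.apply_symm_apply]⟩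
      trans := fun ⟨e, he⟩ ⟨f, hf⟩ => ⟨e.trans f, fun h x => by
        simp only [Equiv.trans_apply, he, hf]⟩ }

/-- Disjoint union of finite `H`-sets. -/
def FinGSet.sum {H : Type u} [Group H] (X Y : FinGSet H) : FinGSet H where
  carrier := X.carrier ⊕ Y.carrier

/-- Cartesian product of finite `H`-sets, with the diagonal action. -/
def FinGSet.prod {H : Type u} [Group H] (X Y : FinGSet H) : FinGSet H where
  carrier := X.carrier × Y.carrier

/-- The empty `H`-set. -/
def FinGSet.empty (H : Type u) [Group H] : FinGSet H where
  carrier := PEmpty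
  action := { smul := fun _ x => x, one_smul := fun _ => rfl, mul_smul := fun _ _ _ => rfl }

/-- The one-point `H`-set. -/
def FinGSet.point (H : Type u) [Group H] : FinGSet H where
  carrier := PUnit
  action := { smul := fun _ x => x, one_smul := fun _ => rfl, mul_smul := fun _ _ _ => rfl }

/-- Isomorphism classes of finite `H`-sets. -/
def BurnsideSemiring (H : Type u) [Group H] : Type (u + 1) := Quotient (FinGSet.setoid H)

/-- The isomorphism class of a finite `H`-set. -/
def FinGSet.cls {H : Type u} [Group H] (X : FinGSet H) : BurnsideSemiring H := Quotient.mk _ X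

theorem FinGSet.Iso.cls_eq {H : Type u} [Group H] {X Y : FinGSet H} (h : X.Iso Y) :
    X.cls = Y.cls := Quotient.sound h

instance BurnsideSemiring.instAdd (H : Type u) [Group H] : Add (BurnsideSemiring H) :=
  ⟨Quotient.map₂ FinGSet.sum fun _ _ ⟨e, he⟩ _ _ ⟨f, hf⟩ => ⟨Equiv.sumCongr e f, by
    rintro h (x | x)
    · exact congrArg Sum.inl (he h x)
    · exact congrArg Sum.inr (hf h x)⟩⟩

instance BurnsideSemiring.instMul (H : Type u) [Group H] : Mul (BurnsideSemiring H) :=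
  ⟨Quotient.map₂ FinGSet.prod fun _ _ ⟨e, he⟩ _ _ ⟨f, hf⟩ => ⟨Equiv.prodCongr e f, by
    rintro h ⟨x, y⟩
    exact Prod.ext (he h x) (hf h y)⟩⟩

instance BurnsideSemiring.instZero (H : Type u) [Group H] : Zero (BurnsideSemiring H) :=
  ⟨(FinGSet.empty H).cls⟩

instance BurnsideSemiring.instOne (H : Type u) [Group H] : One (BurnsideSemiring H) :=
  ⟨(FinGSet.point H).cls⟩

/-- Isomorphism classes of finite `H`-sets form a commutative semiring under disjoint union and
Cartesian product. -/
instance BurnsideSemiring.instCommSemiring (H : Type u) [Group H] :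
    CommSemiring (BurnsideSemiring H) :=
  { BurnsideSemiring.instAdd H, BurnsideSemiring.instMul H, BurnsideSemiring.instZero H,
    BurnsideSemiring.instOne H with
    nsmul := nsmulRec
    add_assoc := by
      rintro ⟨X⟩ ⟨Y⟩ ⟨Z⟩
      refine FinGSet.Iso.cls_eq ⟨Equiv.sumAssoc _ _ _, ?_⟩
      rintro h ((x | x) | x) <;> rfl
    zero_add := by
      rintro ⟨X⟩
      refine FinGSet.Iso.cls_eq ⟨Equiv.emptySum PEmpty _, ?_⟩
      rintro h (x | x)
      · exact x.elim
      · rfl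
    add_zero := by
      rintro ⟨X⟩
      refine FinGSet.Iso.cls_eq ⟨Equiv.sumEmpty _ PEmpty, ?_⟩
      rintro h (x | x)
      · rfl
      · exact x.elim
    add_comm := by
      rintro ⟨X⟩ ⟨Y⟩
      refine FinGSet.Iso.cls_eq ⟨Equiv.sumComm _ _, ?_⟩
      rintro h (x | x) <;> rfl
    mul_assoc := by
      rintro ⟨X⟩ ⟨Y⟩ ⟨Z⟩
      exact FinGSet.Iso.cls_eq ⟨Equiv.prodAssoc _ _ _, fun _ _ => rfl⟩
    one_mul := by
      rintro ⟨X⟩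
      exact FinGSet.Iso.cls_eq ⟨Equiv.punitProd _, fun _ _ => rfl⟩
    mul_one := by
      rintro ⟨X⟩
      exact FinGSet.Iso.cls_eq ⟨Equiv.prodPUnit _, fun _ _ => rfl⟩
    mul_comm := by
      rintro ⟨X⟩ ⟨Y⟩
      exact FinGSet.Iso.cls_eq ⟨Equiv.prodComm _ _, fun _ _ => rfl⟩
    zero_mul := by
      rintro ⟨X⟩
      exact FinGSet.Iso.cls_eq ⟨Equiv.pemptyProd _, fun _ x => x.1.elim⟩
    mul_zero := by
      rintro ⟨X⟩
      exact FinGSet.Iso.cls_eq ⟨Equiv.prodPEmpty _, fun _ x => x.2.elim⟩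
    left_distrib := by
      rintro ⟨X⟩ ⟨Y⟩ ⟨Z⟩
      refine FinGSet.Iso.cls_eq ⟨Equiv.prodSumDistrib _ _ _, ?_⟩
      rintro h ⟨x, (y | y)⟩ <;> rfl
    right_distrib := by
      rintro ⟨X⟩ ⟨Y⟩ ⟨Z⟩
      refine FinGSet.Iso.cls_eq ⟨Equiv.sumProdDistrib _ _ _, ?_⟩
      rintro h ⟨(x | x), y⟩ <;> rfl }

theorem FinGSet.cls_sum {H : Type u} [Group H] (X Y : FinGSet H) :
    (X.sum Y).cls = X.cls + Y.cls := rfl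

theorem FinGSet.cls_prod {H : Type u} [Group H] (X Y : FinGSet H) :
    (X.prod Y).cls = X.cls * Y.cls := rfl

/-- The Burnside ring `A(H)`. -/
abbrev BurnsideRing (H : Type u) [Group H] : Type (u + 1) :=
  GrothendieckRing (BurnsideSemiring H)

/-- The class in `A(H)` of a finite `H`-set. -/
def burnsideOf (H : Type u) [Group H] : BurnsideSemiring H →+* BurnsideRing H :=
  GrothendieckRing.of _

/-- The number of `I`-fixed points, as a homomorphism of semirings. -/
def fixedCard {H : Type u} [Group H] (I : Subgroup H) : BurnsideSemiring H →+* ℤ where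
  toFun := Quotient.lift (fun X => (Nat.card (MulAction.fixedPoints I X.carrier) : ℤ))
    fun X Y ⟨e, he⟩ => by
      have he' : ∀ x, x ∈ MulAction.fixedPoints I X.carrier ↔
          e x ∈ MulAction.fixedPoints I Y.carrier := fun x => by
        simp only [MulAction.mem_fixedPoints]
        refine forall_congr' fun i => ?_
        rw [← e.apply_eq_iff_eq]
        exact iff_of_eq (congrArg (· = e x) (he i x))
      exact congrArg Nat.cast (Nat.card_congr (e.subtypeEquiv he'))
  map_one' := by
    change ((Nat.card (MulAction.fixedPoints I (FinGSet.point H).carrier) : ℕ) : ℤ) = 1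
    have : MulAction.fixedPoints I (FinGSet.point H).carrier = Set.univ :=
      Set.eq_univ_of_forall fun _ _ => rfl
    rw [this, Nat.card_congr (Equiv.Set.univ _)]
    simp [FinGSet.point]
  map_zero' := by
    change ((Nat.card (MulAction.fixedPoints I (FinGSet.empty H).carrier) : ℕ) : ℤ) = 0
    have : IsEmpty (FinGSet.empty H).carrier := inferInstanceAs (IsEmpty PEmpty)
    simp
  map_add' := by
    rintro ⟨X⟩ ⟨Y⟩
    change ((Nat.card (MulAction.fixedPoints I (X.carrier ⊕ Y.carrier)) : ℕ) : ℤ) =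
      (Nat.card (MulAction.fixedPoints I X.carrier) : ℤ)
        + (Nat.card (MulAction.fixedPoints I Y.carrier) : ℤ)
    rw [← Nat.cast_add, ← Nat.card_sum]
    refine congrArg Nat.cast (Nat.card_congr (Equiv.subtypeSum.trans (Equiv.sumCongr ?_ ?_)))
    · refine Equiv.subtypeEquivRight fun x => ?_
      simp [MulAction.mem_fixedPoints]
    · refine Equiv.subtypeEquivRight fun x => ?_
      simp [MulAction.mem_fixedPoints]
  map_mul' := by
    rintro ⟨X⟩ ⟨Y⟩
    change ((Nat.card (MulAction.fixedPoints I (X.carrier × Y.carrier)) : ℕ) : ℤ) =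
      (Nat.card (MulAction.fixedPoints I X.carrier) : ℤ)
        * (Nat.card (MulAction.fixedPoints I Y.carrier) : ℤ)
    rw [← Nat.cast_mul, ← Nat.card_prod]
    refine congrArg Nat.cast (Nat.card_congr ?_)
    refine (Equiv.subtypeEquivRight fun x => ?_).trans (Equiv.subtypeProdEquivProd
      (p := (· ∈ MulAction.fixedPoints I X.carrier))
      (q := (· ∈ MulAction.fixedPoints I Y.carrier)))
    simp [MulAction.mem_fixedPoints, Prod.ext_iff, forall_and]

/-- The mark homomorphism `φ_H^I : A(H) → ℤ`, `X ↦ |X^I|`. -/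
def mark {H : Type u} [Group H] (I : Subgroup H) : BurnsideRing H →+* ℤ :=
  GrothendieckRing.lift (fixedCard I)

/-- The mark homomorphism modulo `p`; `ZMod 0` is `ℤ`. -/
def markMod {H : Type u} [Group H] (p : ℕ) (I : Subgroup H) : BurnsideRing H →+* ZMod p :=
  (Int.castRingHom (ZMod p)).comp (mark I)

/-- Restriction of a finite `H`-set along a homomorphism `φ : K → H`. -/
def FinGSet.res {K H : Type u} [Group K] [Group H] (φ : K →* H) (X : FinGSet H) : FinGSet K where
  carrier := X.carrier
  action := MulAction.compHom X.carrier φ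

/-- Restriction on isomorphism classes. -/
def resSemiring {K H : Type u} [Group K] [Group H] (φ : K →* H) :
    BurnsideSemiring H →+* BurnsideSemiring K where
  toFun := Quotient.map (FinGSet.res φ) fun _ _ ⟨e, he⟩ => ⟨e, fun k x => he (φ k) x⟩
  map_one' := FinGSet.Iso.cls_eq ⟨Equiv.refl PUnit, fun _ _ => rfl⟩
  map_zero' := FinGSet.Iso.cls_eq ⟨Equiv.refl PEmpty, fun _ x => x.elim⟩
  map_add' := by
    rintro ⟨X⟩ ⟨Y⟩
    refine FinGSet.Iso.cls_eq ⟨Equiv.refl (X.carrier ⊕ Y.carrier), ?_⟩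
    rintro k (x | x) <;> rfl
  map_mul' := by
    rintro ⟨X⟩ ⟨Y⟩
    exact FinGSet.Iso.cls_eq ⟨Equiv.refl (X.carrier × Y.carrier), fun _ _ => rfl⟩

/-- Restriction `A(H) → A(K)` along `φ : K → H`. -/
def res {K H : Type u} [Group K] [Group H] (φ : K →* H) : BurnsideRing H →+* BurnsideRing K :=
  GrothendieckRing.lift ((burnsideOf K).comp (resSemiring φ))

/-- The relation on `H × X` whose quotient is `H ×_K X`: `(h φ(k), x) ~ (h, k x)`. -/
def indSetoid {K H : Type u} [Group K] [Group H] (φ : K →* H) (X : FinGSet K) :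
    Setoid (H × X.carrier) where
  r a b := ∃ k : K, a.1 = b.1 * φ k ∧ b.2 = k • a.2
  iseqv :=
    { refl := fun _ => ⟨1, by simp⟩
      symm := fun ⟨k, h1, h2⟩ => ⟨k⁻¹, by simp [h1], by simp [h2]⟩
      trans := fun ⟨k, h1, h2⟩ ⟨l, h3, h4⟩ =>
        ⟨l * k, by rw [h1, h3, map_mul, mul_assoc], by rw [h4, h2, mul_smul]⟩ }

/-- Induction `H ×_K X` of a finite `K`-set along `φ : K → H`; `H` acts by left multiplication on
the first factor. -/
def FinGSet.ind {K H : Type u} [Group K] [Group H] [Finite H] (φ : K →* H) (X : FinGSet K) :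
    FinGSet H where
  carrier := Quotient (indSetoid φ X)
  finite := Quotient.finite _
  action :=
    { smul := fun h => Quotient.map (fun a => (h * a.1, a.2)) fun _ _ ⟨k, h1, h2⟩ =>
        ⟨k, by simp only [h1, mul_assoc], h2⟩
      one_smul := by
        rintro ⟨a⟩
        exact congrArg (Quotient.mk _) (Prod.ext (one_mul a.1) rfl)
      mul_smul := by
        rintro g h ⟨a⟩
        exact congrArg (Quotient.mk _) (Prod.ext (mul_assoc g h a.1) rfl) }

/-- Induction on isomorphism classes. -/
def indSemiring {K H : Type u} [Group K] [Group H] [Finite H] (φ : K →* H) :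
    BurnsideSemiring K →+ BurnsideSemiring H where
  toFun := Quotient.map (FinGSet.ind φ) fun X Y ⟨e, he⟩ =>
    ⟨Quotient.congr (Equiv.prodCongr (Equiv.refl H) e) fun a b =>
      exists_congr fun k => and_congr Iff.rfl (by
        change _ ↔ e b.2 = k • e a.2
        rw [← he, e.apply_eq_iff_eq]), by
      rintro h ⟨a⟩
      rfl⟩
  map_zero' := by
    refine FinGSet.Iso.cls_eq (FinGSet.Iso.of_bijective (fun q => ?_) ⟨?_, ?_⟩ ?_)
    · exact Quotient.lift (s := indSetoid φ (FinGSet.empty K)) (fun a => a.2)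
        (fun a => a.2.elim) q
    · rintro ⟨a⟩
      exact a.2.elim
    · intro x
      exact x.elim
    · rintro h ⟨a⟩
      exact a.2.elim
  map_add' := by
    rintro ⟨X⟩ ⟨Y⟩
    refine (FinGSet.Iso.cls_eq (X := (FinGSet.ind φ X).sum (FinGSet.ind φ Y))
      (Y := FinGSet.ind φ (X.sum Y)) (FinGSet.Iso.of_bijective
      (Sum.elim
        (Quotient.map (fun a : H × X.carrier => ((a.1, Sum.inl a.2) : H × (X.sum Y).carrier))
          fun a b ⟨k, h1, h2⟩ => ⟨k, h1, congrArg Sum.inl h2⟩)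
        (Quotient.map (fun a : H × Y.carrier => ((a.1, Sum.inr a.2) : H × (X.sum Y).carrier))
          fun a b ⟨k, h1, h2⟩ => ⟨k, h1, congrArg Sum.inr h2⟩)) ⟨?_, ?_⟩ ?_)).symm
    · rintro (a | a) (b | b) hab <;> obtain ⟨a, rfl⟩ := Quotient.exists_rep a <;>
        obtain ⟨b, rfl⟩ := Quotient.exists_rep b <;>
        obtain ⟨k, h1, h2⟩ := Quotient.exact (s := indSetoid φ (X.sum Y)) hab
      · exact congrArg Sum.inl (Quotient.sound ⟨k, h1, Sum.inl_injective h2⟩)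
      · exact (Sum.inr_ne_inl h2).elim
      · exact (Sum.inl_ne_inr h2).elim
      · exact congrArg Sum.inr (Quotient.sound ⟨k, h1, Sum.inr_injective h2⟩)
    · rintro ⟨h, x | y⟩
      · exact ⟨Sum.inl (Quotient.mk _ (h, x)), rfl⟩
      · exact ⟨Sum.inr (Quotient.mk _ (h, y)), rfl⟩
    · rintro h (a | a) <;> obtain ⟨a, rfl⟩ := Quotient.exists_rep a <;> rfl

/-- Transfer `A(K) → A(H)` along `φ : K → H`, `X ↦ H ×_K X`. -/
def tr {K H : Type u} [Group K] [Group H] [Finite H] (φ : K →* H) :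
    BurnsideRing K →+ BurnsideRing H :=
  GrothendieckRing.liftAdd ((burnsideOf H : BurnsideSemiring H →+ BurnsideRing H).comp
    (indSemiring φ))

/-- Coinduction `Map_K(H, X)` of a finite `K`-set along `φ : K → H`, with
`(h • s)(g) = s (g h)`. -/
def FinGSet.coind {K H : Type u} [Group K] [Group H] [Finite H] (φ : K →* H) (X : FinGSet K) :
    FinGSet H where
  carrier := {s : H → X.carrier // ∀ (k : K) (g : H), s (φ k * g) = k • s g}
  action :=
    { smul := fun h s => ⟨fun g => s.1 (g * h), fun k g => by
        change s.1 (φ k * g * h) = k • s.1 (g * h)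
        rw [mul_assoc, s.2]⟩
      one_smul := fun s => Subtype.ext (funext fun g => congrArg s.1 (mul_one g))
      mul_smul := fun h h' s => Subtype.ext (funext fun g =>
        congrArg s.1 (mul_assoc g h h').symm) }

/-- Coinduction on isomorphism classes. -/
def coindSemiring {K H : Type u} [Group K] [Group H] [Finite H] (φ : K →* H) :
    BurnsideSemiring K → BurnsideSemiring H :=
  Quotient.map (FinGSet.coind φ) fun X Y ⟨e, he⟩ =>
    ⟨{ toFun := fun s => ⟨fun g => e (s.1 g), fun k g =>
        (congrArg e (s.2 k g)).trans (he k (s.1 g))⟩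
       invFun := fun s => ⟨fun g => e.symm (s.1 g), fun k g =>
        (congrArg e.symm (s.2 k g)).trans (by
          rw [Equiv.symm_apply_eq, he, Equiv.apply_symm_apply])⟩
       left_inv := fun s => Subtype.ext (funext fun g => e.symm_apply_apply _)
       right_inv := fun s => Subtype.ext (funext fun g => e.apply_symm_apply _) },
      fun h s => rfl⟩

/-- The `K`-maps `s : H → X ⊔ Z` such that every colour `i < n` of the colouring `c` of `Z` occurs
among the values of `s`. -/
def FinGSet.coindHit {K H : Type u} [Group K] [Group H] [Finite H] (φ : K →* H) (X Z : FinGSet K)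
    (c : Z.carrier → ℕ) (n : ℕ) :
    FinGSet H where
  carrier := {s : (FinGSet.coind φ (X.sum Z)).carrier //
    ∀ i < n, ∃ (g : H) (z : Z.carrier), s.1 g = Sum.inr z ∧ c z = i}
  action :=
    { smul := fun h s => ⟨h • s.1, fun i hi => by
        obtain ⟨g, z, h1, h2⟩ := s.2 i hi
        refine ⟨g * h⁻¹, z, ?_, h2⟩
        change s.1.1 (g * h⁻¹ * h) = _
        rw [inv_mul_cancel_right, h1]⟩
      one_smul := fun s => Subtype.ext (one_smul H s.1)
      mul_smul := fun h h' s => Subtype.ext (mul_smul h h' s.1) }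

theorem FinGSet.cls_eq_add {H : Type u} [Group H] {W W₁ W₂ : FinGSet H}
    (f₁ : W₁.carrier → W.carrier) (f₂ : W₂.carrier → W.carrier)
    (h₁ : ∀ (h : H) x, f₁ (h • x) = h • f₁ x) (h₂ : ∀ (h : H) x, f₂ (h • x) = h • f₂ x)
    (hb : Function.Bijective (Sum.elim f₁ f₂)) : W.cls = W₁.cls + W₂.cls := by
  refine (FinGSet.Iso.cls_eq (X := W₁.sum W₂) (FinGSet.Iso.of_bijective (Sum.elim f₁ f₂) hb
    ?_)).symm
  rintro h (x | x)
  · exact h₁ h x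
  · exact h₂ h x

theorem FinGSet.cls_coindHit_sum {K H : Type u} [Group K] [Group H] [Finite H] (φ : K →* H)
    (X Y Z : FinGSet K) (c : Z.carrier → ℕ) (n : ℕ) (hc : ∀ z, c z < n) :
    (FinGSet.coindHit φ (X.sum Y) Z c n).cls = (FinGSet.coindHit φ X Z c n).cls +
      (FinGSet.coindHit φ X (Y.sum Z) (Sum.elim (fun _ => n) c) (n + 1)).cls := by
  let j₁ : X.carrier ⊕ Z.carrier → (X.carrier ⊕ Y.carrier) ⊕ Z.carrier := Sum.map Sum.inl id
  let j₂ : X.carrier ⊕ (Y.carrier ⊕ Z.carrier) → (X.carrier ⊕ Y.carrier) ⊕ Z.carrier :=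
    (Equiv.sumAssoc _ _ _).symm
  have hj₁ : Function.Injective j₁ := Sum.inl_injective.sumMap Function.injective_id
  have hj₂ : Function.Injective j₂ := Equiv.injective _
  have ej₁ : ∀ (k : K) x, j₁ (k • x) = k • j₁ x := by rintro k (x | x) <;> rfl
  have ej₂ : ∀ (k : K) x, j₂ (k • x) = k • j₂ x := by rintro k (x | x | x) <;> rfl
  let f₁ : (FinGSet.coindHit φ X Z c n).carrier → (FinGSet.coindHit φ (X.sum Y) Z c n).carrier :=
    fun s => ⟨⟨fun g => j₁ (s.1.1 g), fun k g => (congrArg j₁ (s.1.2 k g)).trans (ej₁ k _)⟩,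
      fun i hi => by
        obtain ⟨g, z, h1, h2⟩ := s.2 i hi
        exact ⟨g, z, congrArg j₁ h1, h2⟩⟩
  let f₂ : (FinGSet.coindHit φ X (Y.sum Z) (Sum.elim (fun _ => n) c) (n + 1)).carrier →
      (FinGSet.coindHit φ (X.sum Y) Z c n).carrier :=
    fun s => ⟨⟨fun g => j₂ (s.1.1 g), fun k g => (congrArg j₂ (s.1.2 k g)).trans (ej₂ k _)⟩,
      fun i hi => by
        obtain ⟨g, z | z, h1, h2⟩ := s.2 i (by omega)
        · exact absurd h2.symm hi.ne
        · exact ⟨g, z, congrArg j₂ h1, h2⟩⟩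
  have hne : ∀ s t, f₁ s ≠ f₂ t := by
    intro s t hst
    obtain ⟨g, z | z, h1, h2⟩ := t.2 n (by omega)
    · have h3 : j₁ (s.1.1 g) = j₂ (t.1.1 g) := congrFun (congrArg (fun w => w.1.1) hst) g
      rw [h1] at h3
      rcases h4 : s.1.1 g with x | x <;> rw [h4] at h3
      · exact Sum.inl_ne_inr (Sum.inl_injective h3)
      · exact Sum.inr_ne_inl h3
    · exact absurd h2 (hc z).ne
  refine FinGSet.cls_eq_add f₁ f₂ (fun h s => rfl) (fun h s => rfl) ⟨?_, ?_⟩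
  · rintro (s | s) (t | t) hst
    · refine congrArg Sum.inl (Subtype.ext (Subtype.ext (funext fun g => hj₁ ?_)))
      exact congrFun (congrArg (fun w => w.1.1) hst) g
    · exact (hne s t hst).elim
    · exact (hne t s hst.symm).elim
    · refine congrArg Sum.inr (Subtype.ext (Subtype.ext (funext fun g => hj₂ ?_)))
      exact congrFun (congrArg (fun w => w.1.1) hst) g
  · intro s
    by_cases hs : ∃ (g : H) (y : Y.carrier), s.1.1 g = Sum.inl (Sum.inr y)
    · refine ⟨Sum.inr ⟨⟨fun g => Equiv.sumAssoc _ _ _ (s.1.1 g), fun k g => hj₂ ?_⟩, ?_⟩, ?_⟩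
      · have h3 : ∀ g, s.1.1 g = j₂ (Equiv.sumAssoc _ _ _ (s.1.1 g)) :=
          fun g => (Equiv.symm_apply_apply (Equiv.sumAssoc X.carrier Y.carrier Z.carrier) _).symm
        exact ((h3 _).symm.trans ((s.1.2 k g).trans (congrArg (k • ·) (h3 g)))).trans
          (ej₂ k _).symm
      · intro i hi
        rcases (Nat.lt_succ_iff.mp hi).eq_or_lt with rfl | hi'
        · obtain ⟨g, y, h⟩ := hs
          exact ⟨g, Sum.inl y, congrArg (Equiv.sumAssoc _ _ _) h, rfl⟩
        · obtain ⟨g, z, h1, h2⟩ := s.2 i hi'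
          exact ⟨g, Sum.inr z, congrArg (Equiv.sumAssoc _ _ _) h1, h2⟩
      · exact Subtype.ext (Subtype.ext (funext fun g => Equiv.symm_apply_apply _ _))
    · have h1 : ∀ g, ∃ w, j₁ w = s.1.1 g := by
        intro g
        rcases h : s.1.1 g with (x | y) | z
        · exact ⟨Sum.inl x, rfl⟩
        · exact (hs ⟨g, y, h⟩).elim
        · exact ⟨Sum.inr z, rfl⟩
      choose t ht using h1
      refine ⟨Sum.inl ⟨⟨t, fun k g => hj₁ ?_⟩, ?_⟩, ?_⟩
      · exact ((ht _).trans ((s.1.2 k g).trans (congrArg (k • ·) (ht g).symm))).trans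
          (ej₁ k (t g)).symm
      · intro i hi
        obtain ⟨g, z, h2, h3⟩ := s.2 i hi
        refine ⟨g, z, hj₁ ?_, h3⟩
        rw [ht, h2]
        rfl
      · exact Subtype.ext (Subtype.ext (funext fun g => ht g))

theorem isAlgebraicMap_coind {K H : Type u} [Group K] [Group H] [Finite H] (φ : K →* H) :
    IsAlgebraicMap fun X : BurnsideSemiring K => burnsideOf H (coindSemiring φ X) := by
  have key : ∀ l : List (BurnsideSemiring K), ∃ (Z : FinGSet K) (c : Z.carrier → ℕ),
      (∀ z, c z < l.length) ∧ ∀ X : FinGSet K,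
        iterDiff l (fun X : BurnsideSemiring K => burnsideOf H (coindSemiring φ X)) X.cls =
          burnsideOf H (FinGSet.coindHit φ X Z c l.length).cls := by
    intro l
    induction l with
    | nil =>
      refine ⟨FinGSet.empty K, fun _ => 0, fun z => z.elim, fun X => ?_⟩
      have h0 : ∀ X : BurnsideSemiring K, X + (FinGSet.empty K).cls = X := add_zero
      have h1 : (FinGSet.coind φ (X.sum (FinGSet.empty K))).cls = coindSemiring φ X.cls := by
        rw [← h0 X.cls]
        rfl
      change burnsideOf H (coindSemiring φ X.cls) = _
      rw [← h1]
      refine congrArg _ (FinGSet.Iso.cls_eq (FinGSet.Iso.of_bijective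
        (fun s => ⟨s, fun i hi => absurd hi (Nat.not_lt_zero i)⟩) ⟨?_, ?_⟩ ?_))
      · intro s t hst
        exact congrArg Subtype.val hst
      · intro s
        exact ⟨s.1, rfl⟩
      · intro h s
        rfl
    | cons y l ih =>
      obtain ⟨Z, c, hc, hZ⟩ := ih
      obtain ⟨Y, rfl⟩ := Quotient.exists_rep y
      refine ⟨Y.sum Z, Sum.elim (fun _ => l.length) c, ?_, fun X => ?_⟩
      · rintro (z | z)
        · exact Nat.lt_succ_self _
        · exact (hc z).trans (Nat.lt_succ_self _)
      · change iterDiff l _ ((X.sum Y).cls) - iterDiff l _ X.cls = _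
        rw [hZ, hZ, FinGSet.cls_coindHit_sum φ X Y Z c l.length hc, map_add]
        exact add_sub_cancel_left _ _
  refine ⟨Nat.card H + 1, fun l hl => ?_⟩
  obtain ⟨Z, c, -, hZ⟩ := key l
  funext x
  obtain ⟨X, rfl⟩ := Quotient.exists_rep x
  refine (hZ X).trans ?_
  have hempty : IsEmpty (FinGSet.coindHit φ X Z c l.length).carrier := by
    refine ⟨fun s => ?_⟩
    choose g z h1 h2 using fun i : Fin l.length => s.2 i.1 i.2
    have hinj : Function.Injective g := by
      intro i i' h
      have h3 := h1 i
      rw [h, h1 i'] at h3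
      have h4 := Sum.inr_injective h3
      exact Fin.ext (by rw [← h2 i, ← h2 i', h4])
    have h5 := Nat.card_le_card_of_injective g hinj
    rw [Nat.card_eq_fintype_card, Fintype.card_fin] at h5
    omega
  have h0 : (FinGSet.coindHit φ X Z c l.length).cls = 0 :=
    FinGSet.Iso.cls_eq (Y := FinGSet.empty H) (FinGSet.Iso.of_bijective
      (fun s => (hempty.false s).elim) ⟨fun s => (hempty.false s).elim, fun x => x.elim⟩
      fun _ s => (hempty.false s).elim)
  rw [h0, map_zero]
  rfl

/-- `X ↦ Map_K(H, X)` extends uniquely to an algebraic map of Burnside rings. -/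
theorem existsUnique_norm {K H : Type u} [Group K] [Group H] [Finite H] (φ : K →* H) :
    ∃! F : BurnsideRing K → BurnsideRing H, IsAlgebraicMap F ∧
      ∀ X, F (burnsideOf K X) = burnsideOf H (coindSemiring φ X) := by
  obtain ⟨F, hF, hF'⟩ := (isAlgebraicMap_coind φ).exists_extension
  exact ⟨F, ⟨hF, hF'⟩, fun F' h => IsAlgebraicMap.extension_unique h.1 hF
    fun m => (h.2 m).trans (hF' m).symm⟩

/-- The norm `A(K) → A(H)` along `φ : K → H`: the unique algebraic map extending
`X ↦ Map_K(H, X)` from finite `K`-sets to their formal differences. -/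
def norm {K H : Type u} [Group K] [Group H] [Finite H] (φ : K →* H) :
    BurnsideRing K → BurnsideRing H :=
  (existsUnique_norm φ).choose

theorem norm_isAlgebraicMap {K H : Type u} [Group K] [Group H] [Finite H] (φ : K →* H) :
    IsAlgebraicMap (norm φ) := (existsUnique_norm φ).choose_spec.1.1

theorem norm_of {K H : Type u} [Group K] [Group H] [Finite H] (φ : K →* H)
    (X : BurnsideSemiring K) :
    norm φ (burnsideOf K X) = burnsideOf H (coindSemiring φ X) :=
  (existsUnique_norm φ).choose_spec.1.2 X

/-- The subgroup `H^g = g⁻¹ H g`. -/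
def conjSubgroup {G : Type u} [Group G] (g : G) (H : Subgroup G) : Subgroup G :=
  H.comap (MulAut.conj g).toMonoidHom

/-- Restriction `A_G(G/H) → A_G(G/K)` for `K ≤ H ≤ G`, where `A_G(G/H) = A(H)`. -/
def resLe {G : Type u} [Group G] {K H : Subgroup G} (h : K ≤ H) :
    BurnsideRing H →+* BurnsideRing K :=
  res (Subgroup.inclusion h)

/-- Transfer `A_G(G/K) → A_G(G/H)` for `K ≤ H ≤ G`. -/
def trLe {G : Type u} [Group G] [Finite G] {K H : Subgroup G} (h : K ≤ H) :
    BurnsideRing K →+ BurnsideRing H :=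
  tr (Subgroup.inclusion h)

/-- Norm `A_G(G/K) → A_G(G/H)` for `K ≤ H ≤ G`. -/
def normLe {G : Type u} [Group G] [Finite G] {K H : Subgroup G} (h : K ≤ H) :
    BurnsideRing K → BurnsideRing H :=
  norm (Subgroup.inclusion h)

/-- Conjugation `c_{g,H} : A_G(G/H) → A_G(G/H^g)`: the `H`-set `X` becomes an `H^g`-set on which
`x ∈ H^g` acts as `g x g⁻¹ ∈ H`. -/
def conjRes {G : Type u} [Group G] (g : G) (H : Subgroup G) :
    BurnsideRing H →+* BurnsideRing (conjSubgroup g H) :=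
  res ((MulAut.conj g).toMonoidHom.subgroupComap H)

/-- An ideal of the Burnside Tambara functor `A_G`: an ideal of `A_G(G/H)` for each `H ≤ G`,
compatible with restriction, transfer, norm and conjugation. -/
@[ext]
structure TambaraIdeal (G : Type u) [Group G] [Finite G] where
  level : ∀ H : Subgroup G, Ideal (BurnsideRing H)
  res_mem : ∀ {K H : Subgroup G} (h : K ≤ H), ∀ a ∈ level H, resLe h a ∈ level K
  tr_mem : ∀ {K H : Subgroup G} (h : K ≤ H), ∀ a ∈ level K, trLe h a ∈ level H
  norm_mem : ∀ {K H : Subgroup G} (h : K ≤ H), ∀ a ∈ level K,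
    ∃ b ∈ level H, normLe h a = b + normLe h 0
  conj_mem : ∀ (g : G) (H : Subgroup G), ∀ a ∈ level H,
    conjRes g H a ∈ level (conjSubgroup g H)

/-- Ideals are ordered by inclusion at every level. -/
instance TambaraIdeal.instPartialOrder (G : Type u) [Group G] [Finite G] :
    PartialOrder (TambaraIdeal G) :=
  PartialOrder.lift TambaraIdeal.level fun _ _ h => TambaraIdeal.ext h

/-- The product `IJ` at level `G/H`: the elements `f₊(ab)` with `f : A → G/H` a map of finite
`G`-sets, `a ∈ I(A)` and `b ∈ J(A)`. Up to isomorphism over `G/H`, such an `A` is a finite disjoint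
union of orbits `G/Kᵢ` with `Kᵢ ≤ H`, mapped to `G/H` by the projections; then `a = (aᵢ)` with
`aᵢ ∈ I(G/Kᵢ)`, `b = (bᵢ)` with `bᵢ ∈ J(G/Kᵢ)`, and `f₊(ab)` is the sum of the transfers of the
`aᵢ bᵢ`. -/
def TambaraIdeal.mulLevel {G : Type u} [Group G] [Finite G] (I J : TambaraIdeal G)
    (H : Subgroup G) : Set (BurnsideRing H) :=
  {x | ∃ (n : ℕ) (K : Fin n → Subgroup G) (h : ∀ i, K i ≤ H) (a b : ∀ i, BurnsideRing (K i)),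
    (∀ i, a i ∈ I.level (K i)) ∧ (∀ i, b i ∈ J.level (K i)) ∧
      x = ∑ i, trLe (h i) (a i * b i)}

/-- A prime ideal: a proper ideal `P` such that `IJ ⊆ P` implies `I ⊆ P` or `J ⊆ P`. -/
def TambaraIdeal.IsPrime {G : Type u} [Group G] [Finite G] (P : TambaraIdeal G) : Prop :=
  (∃ H, P.level H ≠ ⊤) ∧ ∀ I J : TambaraIdeal G,
    (∀ H, I.mulLevel J H ⊆ P.level H) → I ≤ P ∨ J ≤ P

/-- The prime spectrum of the Burnside Tambara functor. -/
@[ext]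
structure TambaraSpec (G : Type u) [Group G] [Finite G] where
  ideal : TambaraIdeal G
  isPrime : ideal.IsPrime

/-- Primes are ordered by inclusion. -/
instance TambaraSpec.instPartialOrder (G : Type u) [Group G] [Finite G] :
    PartialOrder (TambaraSpec G) :=
  PartialOrder.lift TambaraSpec.ideal fun _ _ h => TambaraSpec.ext h

/-- The set `V(I)` of primes containing the ideal `I`. -/
def TambaraSpec.V {G : Type u} [Group G] [Finite G] (I : TambaraIdeal G) : Set (TambaraSpec G) :=
  {P | I ≤ P.ideal}

theorem TambaraIdeal.norm_sub_mem {G : Type u} [Group G] [Finite G] (I : TambaraIdeal G)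
    {K H : Subgroup G} (h : K ≤ H) {a : BurnsideRing K} (ha : a ∈ I.level K) :
    normLe h a - normLe h 0 ∈ I.level H := by
  obtain ⟨b, hb, hab⟩ := I.norm_mem h a ha
  rwa [hab, add_sub_cancel_right]

/-- The unit ideal. -/
def TambaraIdeal.top (G : Type u) [Group G] [Finite G] : TambaraIdeal G where
  level _ := ⊤
  res_mem _ _ _ := Submodule.mem_top
  tr_mem _ _ _ := Submodule.mem_top
  norm_mem h a _ := ⟨normLe h a - normLe h 0, Submodule.mem_top, (sub_add_cancel _ _).symm⟩
  conj_mem _ _ _ _ := Submodule.mem_top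

/-- The intersection of a set of ideals. -/
def TambaraIdeal.sInf {G : Type u} [Group G] [Finite G] (S : Set (TambaraIdeal G)) :
    TambaraIdeal G where
  level H := ⨅ I ∈ S, I.level H
  res_mem h a ha := by
    simp only [Submodule.mem_iInf] at ha ⊢
    exact fun I hI => I.res_mem h a (ha I hI)
  tr_mem h a ha := by
    simp only [Submodule.mem_iInf] at ha ⊢
    exact fun I hI => I.tr_mem h a (ha I hI)
  norm_mem h a ha := by
    refine ⟨normLe h a - normLe h 0, ?_, (sub_add_cancel _ _).symm⟩
    simp only [Submodule.mem_iInf] at ha ⊢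
    exact fun I hI => I.norm_sub_mem h (ha I hI)
  conj_mem g H a ha := by
    simp only [Submodule.mem_iInf] at ha ⊢
    exact fun I hI => I.conj_mem g H a (ha I hI)

theorem TambaraIdeal.sInf_le {G : Type u} [Group G] [Finite G] {S : Set (TambaraIdeal G)}
    {I : TambaraIdeal G} (hI : I ∈ S) : TambaraIdeal.sInf S ≤ I :=
  fun _ => iInf₂_le I hI

theorem TambaraIdeal.le_sInf {G : Type u} [Group G] [Finite G] {S : Set (TambaraIdeal G)}
    {I : TambaraIdeal G} (hI : ∀ J ∈ S, I ≤ J) : I ≤ TambaraIdeal.sInf S :=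
  fun H => le_iInf₂ fun J hJ => hI J hJ H

theorem TambaraIdeal.mulLevel_subset {G : Type u} [Group G] [Finite G] {I J L : TambaraIdeal G}
    (hL : I = L ∨ J = L) (H : Subgroup G) : I.mulLevel J H ⊆ L.level H := by
  rintro _ ⟨n, K, h, a, b, ha, hb, rfl⟩
  refine Submodule.sum_mem _ fun i _ => L.tr_mem (h i) _ ?_
  rcases hL with rfl | rfl
  · exact Ideal.mul_mem_right _ _ (ha i)
  · exact Ideal.mul_mem_left _ _ (hb i)

theorem TambaraIdeal.mulLevel_subset_sInf {G : Type u} [Group G] [Finite G]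
    (I J : TambaraIdeal G) (H : Subgroup G) :
    I.mulLevel J H ⊆ (TambaraIdeal.sInf {I, J}).level H := by
  intro x hx
  change x ∈ ⨅ L ∈ ({I, J} : Set (TambaraIdeal G)), L.level H
  rw [Submodule.mem_iInf]
  intro L
  rw [Submodule.mem_iInf]
  intro hL
  exact TambaraIdeal.mulLevel_subset (hL.imp Eq.symm Eq.symm) H hx

theorem TambaraSpec.V_top (G : Type u) [Group G] [Finite G] :
    TambaraSpec.V (TambaraIdeal.top G) = ∅ :=
  Set.eq_empty_of_forall_notMem fun P hP => by
    obtain ⟨H, hH⟩ := P.isPrime.1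
    exact hH (top_le_iff.mp (hP H))

theorem TambaraSpec.mem_V {G : Type u} [Group G] [Finite G] (I : TambaraIdeal G)
    (P : TambaraSpec G) : P ∈ TambaraSpec.V I ↔ I ≤ P.ideal := Iff.rfl

theorem TambaraSpec.V_sInter {G : Type u} [Group G] [Finite G] (A : Set (Set (TambaraSpec G)))
    (hA : A ⊆ Set.range TambaraSpec.V) : ⋂₀ A ∈ Set.range TambaraSpec.V := by
  refine ⟨TambaraIdeal.sInf {J | ∀ I, TambaraSpec.V I ∈ A → I ≤ J}, Set.ext fun P => ?_⟩
  rw [Set.mem_sInter, TambaraSpec.mem_V]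
  constructor
  · intro hP t ht
    obtain ⟨I, rfl⟩ := hA ht
    have h1 : I ≤ TambaraIdeal.sInf {J | ∀ I, TambaraSpec.V I ∈ A → I ≤ J} :=
      TambaraIdeal.le_sInf fun J (hJ : ∀ I, TambaraSpec.V I ∈ A → I ≤ J) => hJ I ht
    exact le_trans h1 hP
  · intro hP
    refine TambaraIdeal.sInf_le ?_
    exact fun I hI => hP _ hI

theorem TambaraSpec.V_union {G : Type u} [Group G] [Finite G] (I J : TambaraIdeal G) :
    TambaraSpec.V (TambaraIdeal.sInf {I, J}) = TambaraSpec.V I ∪ TambaraSpec.V J := by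
  refine Set.ext fun P => ?_
  rw [Set.mem_union, TambaraSpec.mem_V, TambaraSpec.mem_V, TambaraSpec.mem_V]
  constructor
  · intro hP
    exact P.isPrime.2 I J fun H x hx => hP H (TambaraIdeal.mulLevel_subset_sInf I J H hx)
  · rintro (hP | hP)
    · exact le_trans (TambaraIdeal.sInf_le (Set.mem_insert I {J})) hP
    · exact le_trans (TambaraIdeal.sInf_le (Set.mem_insert_of_mem I rfl)) hP

/-- The topology on the spectrum whose closed sets are the sets `V(I)`. -/
instance TambaraSpec.instTopologicalSpace (G : Type u) [Group G] [Finite G] :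
    TopologicalSpace (TambaraSpec G) :=
  TopologicalSpace.ofClosed (Set.range TambaraSpec.V) ⟨TambaraIdeal.top G, TambaraSpec.V_top G⟩
    TambaraSpec.V_sInter
    (by
      rintro _ ⟨I, rfl⟩ _ ⟨J, rfl⟩
      exact ⟨TambaraIdeal.sInf {I, J}, TambaraSpec.V_union I J⟩)

theorem TambaraSpec.isClosed_iff {G : Type u} [Group G] [Finite G] (Z : Set (TambaraSpec G)) :
    IsClosed Z ↔ ∃ I : TambaraIdeal G, Z = TambaraSpec.V I := by
  rw [← isOpen_compl_iff]
  change Zᶜᶜ ∈ Set.range TambaraSpec.V ↔ _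
  rw [compl_compl]
  exact exists_congr fun _ => eq_comm

/-- The family of ideals `𝔭_{C,p}(G/H) = ⋂ ker φ_{H,p}^I`, the intersection being over the
subgroups `I ≤ H` such that `I^g ≤ C` for some `g ∈ G`. -/
def markIdeal {G : Type u} [Group G] (C : Subgroup G) (p : ℕ) (H : Subgroup G) :
    Ideal (BurnsideRing H) :=
  ⨅ (I : Subgroup H) (_ : ∃ g : G, conjSubgroup g (I.map H.subtype) ≤ C),
    RingHom.ker (markMod p I)

/-- The subset `{𝔭_{C,p} | C ≤ G, p prime or 0}` of the spectrum of `A_G`. -/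
def markPrimes (G : Type u) [Group G] [Finite G] : Set (TambaraSpec G) :=
  {P | ∃ (C : Subgroup G) (p : ℕ), (p.Prime ∨ p = 0) ∧ P.ideal.level = markIdeal C p}

end

end BurnsideTambara

namespace BurnsideTambara

noncomputable section

open MulAction

/-! Everything is read off from marks. For abelian `H`, the mark at `I` of a restriction is a mark
of the original element. The mark of a transfer from `K` is the index of `K` times the mark at `I ∩
K` if `I ≤ K`, and zero otherwise. The mark of a norm is the mark at `I ∩ K` raised to the power `[H
: KI]` (`mark_res`, `mark_tr_of_le`, `mark_tr_of_not_le`, `mark_norm`). These formulas make each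
`𝔭_{C,p}` a Tambara ideal. It is prime because norms carry a nonzero mark at `I ≤ C` unchanged to
the mark at `C` itself (`exists_mem_level_markMod_ne_zero`), and there `ℤ/p` is a domain.

The bijection compares two equality criteria. Every prime of `A(G)` is the kernel of a mark modulo
`p` (`exists_eq_ker_markMod`). Two such kernels agree exactly when the characteristics agree and
each subgroup lies in the `p`-saturation of the other. The same condition governs `𝔭_{C,p} =
𝔭_{D,q}` (`ker_markMod_eq_iff_markIdeal_eq`). The `p`-group fixed point congruence gives one
direction, and the element `[H/T] - [H:T]` with `T` a saturation gives the other.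

The orders differ. In `Spec A(G)` a strict inclusion only passes from characteristic zero to a
prime, so the dimension is one. In contrast `𝔭_{C,p} ⊆ 𝔭_{D,q}` means that `q` divides `p` and `D`
lies in the `q`-saturation of `C` (`markIdeal_le_iff`). In characteristic zero this is the reversed
subgroup lattice, and one further step leads to a positive characteristic. A homeomorphism preserves
specialization, hence dimension, which separates the two spaces when `G` is nontrivial. -/

/-! ### Marks of restrictions, transfers and norms. -/

theorem BurnsideRing.exists_eq_sub {H : Type u} [Group H] (a : BurnsideRing H) :
    ∃ X Y : FinGSet H, a = burnsideOf H X.cls - burnsideOf H Y.cls := by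
  obtain ⟨s, t, h⟩ := GrothendieckRing.exists_eq_sub a
  obtain ⟨X, rfl⟩ := Quotient.exists_rep s
  obtain ⟨Y, rfl⟩ := Quotient.exists_rep t
  exact ⟨X, Y, h⟩

theorem BurnsideRing.addHom_ext {H : Type u} [Group H] {B : Type v} [AddCommGroup B]
    {f g : BurnsideRing H →+ B}
    (h : ∀ X : FinGSet H, f (burnsideOf H X.cls) = g (burnsideOf H X.cls)) : f = g := by
  ext a
  obtain ⟨X, Y, rfl⟩ := BurnsideRing.exists_eq_sub a
  rw [map_sub, map_sub, h, h]

theorem mark_of {H : Type u} [Group H] (I : Subgroup H) (X : FinGSet H) :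
    mark I (burnsideOf H X.cls) = Nat.card (fixedPoints I X.carrier) :=
  GrothendieckRing.lift_of (fixedCard I) X.cls

theorem markMod_apply {H : Type u} [Group H] (p : ℕ) (I : Subgroup H) (a : BurnsideRing H) :
    markMod p I a = ((mark I a : ℤ) : ZMod p) := rfl

theorem res_of {K H : Type u} [Group K] [Group H] (φ : K →* H) (X : FinGSet H) :
    res φ (burnsideOf H X.cls) = burnsideOf K (X.res φ).cls :=
  GrothendieckRing.lift_of ((burnsideOf K).comp (resSemiring φ)) X.cls

theorem tr_of {K H : Type u} [Group K] [Group H] [Finite H] (φ : K →* H) (X : FinGSet K) :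
    tr φ (burnsideOf K X.cls) = burnsideOf H (X.ind φ).cls :=
  GrothendieckRing.liftAdd_ofAdd
    ((burnsideOf H : BurnsideSemiring H →+ BurnsideRing H).comp (indSemiring φ)) X.cls

theorem mark_res {K H : Type u} [Group K] [Group H] (φ : K →* H) (I : Subgroup K)
    (a : BurnsideRing H) : mark I (res φ a) = mark (I.map φ) a := by
  suffices h : ((mark I).comp (res φ)).toAddMonoidHom = (mark (I.map φ)).toAddMonoidHom from
    DFunLike.congr_fun h a
  refine BurnsideRing.addHom_ext fun X => ?_
  change mark I (res φ (burnsideOf H X.cls)) = mark (I.map φ) (burnsideOf H X.cls)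
  rw [res_of, mark_of, mark_of]
  refine congrArg Nat.cast (Nat.card_congr (Equiv.subtypeEquivRight fun x => ?_))
  change (∀ k : I, _) ↔ ∀ k : I.map φ, _
  constructor
  · rintro h ⟨_, k, hk, rfl⟩
    exact h ⟨k, hk⟩
  · rintro h ⟨k, hk⟩
    exact h ⟨φ k, k, hk, rfl⟩

theorem markMod_res {K H : Type u} [Group K] [Group H] (φ : K →* H) (p : ℕ) (I : Subgroup K)
    (a : BurnsideRing H) : markMod p I (res φ a) = markMod p (I.map φ) a := by
  rw [markMod_apply, mark_res, markMod_apply]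

/-- By commutativity `φ k • [h, x] = [h φ(k), x] = [h, k x]`, so by injectivity of `φ` the class
`[h, x]` is fixed by `I` exactly when `x` is fixed by the preimage of `I`. Representatives of the
cosets of `φ.range` then give unique normal forms. -/
theorem card_fixedPoints_ind {K H : Type u} [Group K] [CommGroup H] [Finite H] {φ : K →* H}
    (hφ : Function.Injective φ) {I : Subgroup H} (hI : I ≤ φ.range) (X : FinGSet K) :
    Nat.card (fixedPoints I (X.ind φ).carrier) =
      φ.range.index * Nat.card (fixedPoints (I.comap φ) X.carrier) := by
  rw [Subgroup.index, ← Nat.card_prod]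
  symm
  let f : (H ⧸ φ.range) × fixedPoints (I.comap φ) X.carrier →
      fixedPoints I (X.ind φ).carrier := fun a =>
    ⟨Quotient.mk (indSetoid φ X) (a.1.out, a.2.1), by
      rintro ⟨i, hi⟩
      obtain ⟨k, rfl⟩ := hI hi
      refine Quotient.sound (s := indSetoid φ X) ⟨k, mul_comm _ _, ?_⟩
      exact (a.2.2 ⟨k, hi⟩).symm⟩
  refine Nat.card_congr (Equiv.ofBijective f ⟨?_, ?_⟩)
  · rintro ⟨c, x⟩ ⟨d, y⟩ h
    obtain ⟨k, h1, h2⟩ := Quotient.exact (s := indSetoid φ X) (congrArg Subtype.val h)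
    change c.out = d.out * φ k at h1
    change y.1 = k • x.1 at h2
    have hcd : c = d := by
      rw [← Quotient.out_eq' c, ← Quotient.out_eq' d, eq_comm]
      refine QuotientGroup.eq.mpr ⟨k, ?_⟩
      rw [h1, inv_mul_cancel_left]
    subst hcd
    have hk : k = 1 := hφ (by simpa using h1)
    subst hk
    rw [one_smul] at h2
    exact Prod.ext rfl (Subtype.ext h2.symm)
  · rintro ⟨q, hq⟩
    obtain ⟨⟨h, x⟩, rfl⟩ := Quotient.exists_rep q
    obtain ⟨⟨_, l, rfl⟩, hl⟩ := QuotientGroup.mk_out_eq_mul φ.range h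
    refine ⟨⟨(h : H ⧸ φ.range), ⟨l⁻¹ • x, ?_⟩⟩, ?_⟩
    · rintro ⟨k, hk⟩
      obtain ⟨m, h1, h2⟩ := Quotient.exact (s := indSetoid φ X) (hq ⟨φ k, hk⟩)
      change φ k * h = h * φ m at h1
      change x = m • x at h2
      have hkm : k = m := hφ (mul_right_cancel (h1.trans (mul_comm _ _)))
      change k • l⁻¹ • x = l⁻¹ • x
      have hkl : k * l⁻¹ = l⁻¹ * k := hφ (by rw [map_mul, map_mul, mul_comm])
      rw [← mul_smul, hkl, mul_smul, hkm, ← h2]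
    · refine Subtype.ext (Quotient.sound (s := indSetoid φ X) ⟨l, hl, ?_⟩)
      exact (smul_inv_smul l x).symm

theorem mark_tr_of_le {K H : Type u} [Group K] [CommGroup H] [Finite H] {φ : K →* H}
    (hφ : Function.Injective φ) {I : Subgroup H} (hI : I ≤ φ.range) (a : BurnsideRing K) :
    mark I (tr φ a) = φ.range.index * mark (I.comap φ) a := by
  suffices h : (mark I).toAddMonoidHom.comp (tr φ) =
      (AddMonoidHom.mulLeft (φ.range.index : ℤ)).comp (mark (I.comap φ)).toAddMonoidHom from
    DFunLike.congr_fun h a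
  refine BurnsideRing.addHom_ext fun X => ?_
  change mark I (tr φ (burnsideOf K X.cls)) = φ.range.index * mark _ (burnsideOf K X.cls)
  rw [tr_of, mark_of, mark_of, card_fixedPoints_ind hφ hI, Nat.cast_mul]

theorem mark_tr_of_not_le {K H : Type u} [Group K] [CommGroup H] [Finite H] {φ : K →* H}
    {I : Subgroup H} (hI : ¬ I ≤ φ.range) (a : BurnsideRing K) : mark I (tr φ a) = 0 := by
  suffices h : (mark I).toAddMonoidHom.comp (tr φ) = 0 from DFunLike.congr_fun h a
  refine BurnsideRing.addHom_ext fun X => ?_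
  change mark I (tr φ (burnsideOf K X.cls)) = 0
  rw [tr_of, mark_of]
  have : IsEmpty (fixedPoints I (X.ind φ).carrier) := by
    refine ⟨fun ⟨q, hq⟩ => hI fun i hi => ?_⟩
    obtain ⟨⟨h, x⟩, rfl⟩ := Quotient.exists_rep q
    obtain ⟨k, h1, -⟩ := Quotient.exact (s := indSetoid φ X) (hq ⟨i, hi⟩)
    exact ⟨k, mul_left_cancel (h1.symm.trans (mul_comm _ _))⟩
  simp

/-- A fixed `s` satisfies `s (g i) = s g` and `s (φ k g) = k s g`, so one value on each coset of
`φ(K) I` determines it. If `φ k ∈ I`, commutativity gives `k s g = s g`. This is the only constraint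
on these values. -/
theorem card_fixedPoints_coind {K H : Type u} [Group K] [CommGroup H] [Finite H] (φ : K →* H)
    (I : Subgroup H) (X : FinGSet K) :
    Nat.card (fixedPoints I (X.coind φ).carrier) =
      Nat.card (fixedPoints (I.comap φ) X.carrier) ^ (φ.range ⊔ I).index := by
  rw [Subgroup.index, ← Nat.card_fun]
  have hs : ∀ s : fixedPoints I (X.coind φ).carrier, ∀ g : H, ∀ i ∈ I, s.1.1 (g * i) = s.1.1 g :=
    fun s g i hi => congrFun (congrArg Subtype.val (s.2 ⟨i, hi⟩)) g
  let f : fixedPoints I (X.coind φ).carrier →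
      ((H ⧸ (φ.range ⊔ I)) → fixedPoints (I.comap φ) X.carrier) := fun s c =>
    ⟨s.1.1 c.out, by
      rintro ⟨k, hk⟩
      change k • s.1.1 c.out = _
      rw [← s.1.2, mul_comm]
      exact hs s _ _ hk⟩
  refine Nat.card_congr (Equiv.ofBijective f ⟨?_, ?_⟩)
  · intro s t hst
    refine Subtype.ext (Subtype.ext (funext fun g => ?_))
    obtain ⟨⟨w, hw⟩, hl⟩ := QuotientGroup.mk_out_eq_mul (φ.range ⊔ I) g
    obtain ⟨_, ⟨k, rfl⟩, i, hi, rfl⟩ := Subgroup.mem_sup.mp hw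
    have h1 : s.1.1 (QuotientGroup.mk g : H ⧸ (φ.range ⊔ I)).out =
        t.1.1 (QuotientGroup.mk g : H ⧸ (φ.range ⊔ I)).out :=
      congrArg Subtype.val (congrFun hst _)
    rw [hl] at h1
    change s.1.1 (g * (φ k * i)) = t.1.1 (g * (φ k * i)) at h1
    rw [← mul_assoc, hs s _ _ hi, hs t _ _ hi, mul_comm g, s.1.2, t.1.2] at h1
    exact smul_left_cancel k h1
  · intro t
    have hdec : ∀ g : H, ∃ k : K, ∃ i ∈ I,
        g = φ k * (QuotientGroup.mk g : H ⧸ (φ.range ⊔ I)).out * i := by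
      intro g
      obtain ⟨⟨w, hw⟩, hl⟩ := QuotientGroup.mk_out_eq_mul (φ.range ⊔ I) g
      obtain ⟨_, ⟨k, rfl⟩, i, hi, rfl⟩ := Subgroup.mem_sup.mp hw
      refine ⟨k⁻¹, i⁻¹, I.inv_mem hi, ?_⟩
      rw [hl, map_inv]
      change g = (φ k)⁻¹ * (g * (φ k * i)) * i⁻¹
      rw [eq_mul_inv_iff_mul_eq, eq_inv_mul_iff_mul_eq, mul_left_comm]
    -- Two decompositions of one element differ by `k'⁻¹ k` in the preimage of `I`, which fixes the
    -- prescribed value, so the extension does not depend on the choice.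
    have hwd : ∀ (c : H ⧸ (φ.range ⊔ I)) (k k' : K) (i i' : H), i ∈ I → i' ∈ I →
        φ k * c.out * i = φ k' * c.out * i' → k • (t c).1 = k' • (t c).1 := by
      intro c k k' i i' hi hi' h
      have h1 : φ (k'⁻¹ * k) = i' * i⁻¹ := by
        rw [map_mul, map_inv, eq_mul_inv_iff_mul_eq, mul_assoc, inv_mul_eq_iff_eq_mul]
        rw [mul_right_comm, mul_right_comm (φ k')] at h
        exact mul_right_cancel h
      have h2 : (k'⁻¹ * k) • (t c).1 = (t c).1 :=
        (t c).2 ⟨k'⁻¹ * k, by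
          change φ (k'⁻¹ * k) ∈ I
          rw [h1]
          exact I.mul_mem hi' (I.inv_mem hi)⟩
      rwa [mul_smul, inv_smul_eq_iff] at h2
    choose k i hi hki using hdec
    have hval : ∀ (g : H) (l : K) (j : H), j ∈ I →
        g = φ l * (QuotientGroup.mk g : H ⧸ (φ.range ⊔ I)).out * j →
        k g • (t (QuotientGroup.mk g)).1 = l • (t (QuotientGroup.mk g)).1 :=
      fun g l j hj h => hwd _ _ _ _ _ (hi g) hj ((hki g).symm.trans h)
    have hmk : ∀ (l : K) (j : H), j ∈ I → ∀ g : H,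
        (QuotientGroup.mk (φ l * g * j) : H ⧸ (φ.range ⊔ I)) = QuotientGroup.mk g := by
      intro l j hj g
      refine (QuotientGroup.eq.mpr ?_).symm
      have : g⁻¹ * (φ l * g * j) = φ l * j := by
        rw [mul_comm (φ l) g]
        group
      rw [this]
      exact Subgroup.mul_mem_sup ⟨l, rfl⟩ hj
    have hmove : ∀ (l : K) (j : H), j ∈ I → ∀ g : H,
        k (φ l * g * j) • (t (QuotientGroup.mk (φ l * g * j))).1 =
          l • k g • (t (QuotientGroup.mk g)).1 := by
      intro l j hj g
      have h1 : k (φ l * g * j) • (t (QuotientGroup.mk (φ l * g * j))).1 =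
          (l * k g) • (t (QuotientGroup.mk (φ l * g * j))).1 := by
        refine hval _ _ (i g * j) (I.mul_mem (hi g) hj) ?_
        rw [hmk l j hj g]
        conv_lhs => rw [hki g]
        rw [map_mul]
        group
      rw [h1, hmk l j hj g, mul_smul]
    refine ⟨⟨⟨fun g => k g • (t (QuotientGroup.mk g)).1, fun l g => ?_⟩, ?_⟩, ?_⟩
    · simpa using hmove l 1 I.one_mem g
    · rintro ⟨j, hj⟩
      refine Subtype.ext (funext fun g => ?_)
      change k (g * j) • (t (QuotientGroup.mk (g * j))).1 = k g • (t (QuotientGroup.mk g)).1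
      simpa using hmove 1 j hj g
    · refine funext fun c => Subtype.ext ?_
      change k c.out • (t (QuotientGroup.mk c.out)).1 = (t c).1
      have hc : (QuotientGroup.mk c.out : H ⧸ (φ.range ⊔ I)) = c := Quotient.out_eq' c
      have := hval c.out 1 1 I.one_mem (by rw [hc]; simp)
      rw [this, hc, one_smul]

/-- Each difference replaces `Q` by `Q(T + f a) - Q(T)`, where the leading terms cancel. The degree
bound is strict so that `m = 0` forces the zero polynomial. -/
theorem iterDiff_polynomial_eval {M : Type u} [AddCommMonoid M] (f : M →+ ℤ) (P : Polynomial ℤ)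
    (l : List M) : ∀ m : ℕ, P.degree < ((m + l.length : ℕ) : WithBot ℕ) →
      ∃ Q : Polynomial ℤ, Q.degree < (m : WithBot ℕ) ∧
        (iterDiff l fun x => P.eval (f x)) = fun x => Q.eval (f x) := by
  induction l with
  | nil => exact fun m hP => ⟨P, hP, rfl⟩
  | cons a l ih =>
    intro m hP
    obtain ⟨Q, hQ, h⟩ := ih (m + 1) (by rwa [List.length_cons, ← add_assoc, add_right_comm] at hP)
    refine ⟨Q.taylor (f a) - Q, ?_, ?_⟩
    · rcases eq_or_ne Q 0 with rfl | hQ0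
      · simp
      · have h1 := Polynomial.degree_sub_lt_left (Q.degree_taylor (f a))
          (fun h0 => hQ0 ((Polynomial.taylor_eq_zero (f a) Q).mp h0))
          (Polynomial.leadingCoeff_taylor (f a) Q)
        rw [Polynomial.degree_taylor, Polynomial.degree_eq_natDegree hQ0] at h1
        rw [Polynomial.degree_eq_natDegree hQ0, Nat.cast_lt] at hQ
        exact h1.trans_le (Nat.cast_le.mpr (Nat.lt_succ_iff.mp hQ))
    · change fwdDiff a (iterDiff l fun x => P.eval (f x)) = _
      rw [h]
      funext x
      rw [fwdDiff, Polynomial.eval_sub, Polynomial.taylor_eval, map_add]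

theorem isAlgebraicMap_pow {M : Type u} [AddCommMonoid M] (f : M →+ ℤ) (n : ℕ) :
    IsAlgebraicMap fun x => f x ^ n := by
  refine ⟨n + 1, fun l hl => ?_⟩
  obtain ⟨Q, hQ, h⟩ := iterDiff_polynomial_eval f (Polynomial.X ^ n) l 0 (by
    rw [hl, zero_add, Polynomial.degree_X_pow, Nat.cast_lt]
    exact n.lt_succ_self)
  have hQ0 : Q = 0 := by
    by_contra hne
    rw [Polynomial.degree_eq_natDegree hne] at hQ
    exact Nat.not_lt_zero _ (Nat.cast_lt.mp hQ)
  simp only [Polynomial.eval_pow, Polynomial.eval_X] at h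
  rw [h, hQ0]
  funext x
  exact Polynomial.eval_zero

theorem IsAlgebraicMap.addHom_comp {M : Type u} [AddCommMonoid M] {B C : Type*} [AddCommGroup B]
    [AddCommGroup C] {F : M → B} (hF : IsAlgebraicMap F) (f : B →+ C) :
    IsAlgebraicMap fun x => f (F x) := by
  obtain ⟨n, hn⟩ := hF
  refine ⟨n, fun l hl => ?_⟩
  have key : ∀ l : List M, iterDiff l (fun x => f (F x)) = fun x => f (iterDiff l F x) := by
    intro l
    induction l with
    | nil => rfl
    | cons a l ih =>
      change fwdDiff a (iterDiff l fun x => f (F x)) = fun x => f (fwdDiff a (iterDiff l F) x)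
      rw [ih]
      funext x
      simp [fwdDiff]
  rw [key, hn l hl]
  funext x
  exact map_zero f

/-- Both sides are algebraic in `a` and agree on finite `K`-sets by the fixed point count for
coinduction. Uniqueness of algebraic extensions does the rest. -/
theorem mark_norm {K H : Type u} [Group K] [CommGroup H] [Finite H] (φ : K →* H) (I : Subgroup H)
    (a : BurnsideRing K) :
    mark I (norm φ a) = mark (I.comap φ) a ^ (φ.range ⊔ I).index := by
  refine congrFun (IsAlgebraicMap.extension_unique (M := BurnsideSemiring K)
    (F := fun a : BurnsideRing K => mark I (norm φ a))
    (F' := fun a : BurnsideRing K => mark (I.comap φ) a ^ (φ.range ⊔ I).index)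
    ((norm_isAlgebraicMap φ).addHom_comp (mark I).toAddMonoidHom)
    (isAlgebraicMap_pow (mark (I.comap φ)).toAddMonoidHom _) fun m => ?_) a
  obtain ⟨X, rfl⟩ := Quotient.exists_rep m
  change mark I (norm φ (burnsideOf K X.cls)) = mark _ (burnsideOf K X.cls) ^ _
  rw [norm_of, mark_of]
  refine (mark_of I (X.coind φ)).trans ?_
  rw [card_fixedPoints_coind, Nat.cast_pow]

/-! ### Saturations, separating elements and congruences between marks. -/

/-- The finite `H`-set `H ⧸ T`. -/
def FinGSet.quot {H : Type u} [Group H] [Finite H] (T : Subgroup H) : FinGSet H where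
  carrier := H ⧸ T

theorem mark_quot_of_le {H : Type u} [CommGroup H] [Finite H] {I T : Subgroup H} (h : I ≤ T) :
    mark I (burnsideOf H (FinGSet.quot T).cls) = T.index := by
  rw [mark_of, Subgroup.index]
  refine congrArg Nat.cast (Nat.card_congr (Equiv.subtypeUnivEquiv fun q => ?_))
  rintro ⟨i, hi⟩
  obtain ⟨x, rfl⟩ := QuotientGroup.mk_surjective q
  refine QuotientGroup.eq.mpr ?_
  change (i * x)⁻¹ * x ∈ T
  rw [mul_inv_rev, mul_comm, mul_inv_cancel_left]
  exact T.inv_mem (h hi)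

theorem mark_quot_of_not_le {H : Type u} [CommGroup H] [Finite H] {I T : Subgroup H}
    (h : ¬ I ≤ T) : mark I (burnsideOf H (FinGSet.quot T).cls) = 0 := by
  rw [mark_of]
  have : IsEmpty (fixedPoints I (FinGSet.quot T).carrier) := by
    refine ⟨fun ⟨q, hq⟩ => h fun i hi => ?_⟩
    obtain ⟨x, rfl⟩ := QuotientGroup.mk_surjective q
    have h1 := QuotientGroup.eq.mp (hq ⟨i, hi⟩)
    change (i * x)⁻¹ * x ∈ T at h1
    rw [mul_inv_rev, mul_comm, mul_inv_cancel_left] at h1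
    exact T.inv_mem_iff.mp h1
  simp

/-- The elements of `H` having a `p`-power in `J`; for `p = 0` this is `J` itself. -/
def powerSaturation {H : Type u} [CommGroup H] (p : ℕ) (J : Subgroup H) : Subgroup H where
  -- The base `max p 1` is `1` for `p = 0`, so the only power then is the first one.
  carrier := {x | ∃ k : ℕ, x ^ max p 1 ^ k ∈ J}
  one_mem' := ⟨0, by simp⟩
  mul_mem' := by
    rintro x y ⟨k, hk⟩ ⟨l, hl⟩
    refine ⟨k + l, ?_⟩
    rw [mul_pow, pow_add, pow_mul, mul_comm (max p 1 ^ k) (max p 1 ^ l), pow_mul y]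
    exact J.mul_mem (J.pow_mem hk _) (J.pow_mem hl _)
  inv_mem' := by
    rintro x ⟨k, hk⟩
    exact ⟨k, by rw [inv_pow]; exact J.inv_mem hk⟩

theorem le_powerSaturation {H : Type u} [CommGroup H] (p : ℕ) (J : Subgroup H) :
    J ≤ powerSaturation p J := fun x hx => ⟨0, by simpa using hx⟩

theorem powerSaturation_zero {H : Type u} [CommGroup H] (J : Subgroup H) :
    powerSaturation 0 J = J :=
  le_antisymm (fun x ⟨k, hk⟩ => by simpa using hk) (le_powerSaturation 0 J)

theorem powerSaturation_mono {H : Type u} [CommGroup H] (p : ℕ) {I J : Subgroup H} (h : I ≤ J) :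
    powerSaturation p I ≤ powerSaturation p J := fun _ ⟨k, hk⟩ => ⟨k, h hk⟩

/-- An element whose `p`-th power lies in the saturation lies there already, so the quotient has no
element of order `p` and Cauchy's theorem applies. For `p = 0` only finiteness of the index is
needed. -/
theorem index_powerSaturation_ne_zero {H : Type u} [CommGroup H] [Finite H] {p : ℕ}
    (hp : p.Prime ∨ p = 0) (J : Subgroup H) : ((powerSaturation p J).index : ZMod p) ≠ 0 := by
  rw [Ne, ZMod.natCast_eq_zero_iff]
  intro h
  rcases hp with hp | rfl
  · have : Fact p.Prime := ⟨hp⟩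
    obtain ⟨q, hq⟩ := exists_prime_orderOf_dvd_card' (G := H ⧸ powerSaturation p J) p h
    obtain ⟨x, rfl⟩ := QuotientGroup.mk_surjective q
    have h1 : x ∈ powerSaturation p J := by
      have h2 : ((x ^ p : H) : H ⧸ powerSaturation p J) = 1 := by
        rw [QuotientGroup.mk_pow]
        exact orderOf_dvd_iff_pow_eq_one.mp hq.dvd
      obtain ⟨k, hk⟩ := (QuotientGroup.eq_one_iff _).mp h2
      refine ⟨k + 1, ?_⟩
      rw [max_eq_left hp.one_le] at hk ⊢
      rwa [pow_succ', pow_mul]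
    rw [(QuotientGroup.eq_one_iff x).mpr h1, orderOf_one] at hq
    exact hp.one_lt.ne hq
  · exact Subgroup.index_ne_zero_of_finite (zero_dvd_iff.mp h)

/-- The difference `[H ⧸ T] - [H : T]` for `T = powerSaturation p J`. -/
def separator {H : Type u} [CommGroup H] [Finite H] (p : ℕ) (J : Subgroup H) : BurnsideRing H :=
  burnsideOf H (FinGSet.quot (powerSaturation p J)).cls - ((powerSaturation p J).index : ℕ)

theorem mark_separator {H : Type u} [CommGroup H] [Finite H] (p : ℕ) {I J : Subgroup H}
    (h : I ≤ powerSaturation p J) : mark I (separator p J) = 0 := by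
  rw [separator, map_sub, mark_quot_of_le h, map_natCast, sub_self]

/-- Outside the saturation `H/T` has no fixed points, so the mark is `-[H : T]`, which is nonzero
modulo `p`. Together with `mark_separator`, this one element detects containment in `T`. -/
theorem le_of_markMod_separator {H : Type u} [CommGroup H] [Finite H] {p : ℕ}
    (hp : p.Prime ∨ p = 0) {I J : Subgroup H} (h : markMod p I (separator p J) = 0) :
    I ≤ powerSaturation p J := by
  by_contra hI
  rw [separator, map_sub, markMod_apply, mark_quot_of_not_le hI, map_natCast, Int.cast_zero,
    zero_sub, neg_eq_zero] at h
  exact index_powerSaturation_ne_zero hp J h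

/-- A commutative group acts on the fixed points of each of its subgroups. -/
def fixedPointsPerm {H : Type u} [CommGroup H] (I J : Subgroup H) (X : FinGSet H) :
    J →* Equiv.Perm (fixedPoints I X.carrier) :=
  MonoidHom.toHomPerm
    { toFun := fun j x => ⟨(j : H) • x.1, fun i => by
        change (i : H) • (j : H) • x.1 = (j : H) • x.1
        rw [← mul_smul, mul_comm, mul_smul]
        exact congrArg ((j : H) • ·) (x.2 i)⟩
      map_one' := funext fun x => Subtype.ext (one_smul H x.1)
      map_mul' := fun j k => funext fun x => Subtype.ext (mul_smul (j : H) (k : H) x.1) }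

/-- `J` acts on `X^I` with `I` acting trivially, and every element of `J` has a `p`-power in `I`.
Hence a `p`-group acts on `X^I`, with fixed points `X^J`. -/
theorem card_fixedPoints_modEq {H : Type u} [CommGroup H] {p : ℕ} (hp : p.Prime)
    {I J : Subgroup H} (hIJ : I ≤ J) (hJI : J ≤ powerSaturation p I) (X : FinGSet H) :
    Nat.card (fixedPoints I X.carrier) ≡ Nat.card (fixedPoints J X.carrier) [MOD p] := by
  have : Fact p.Prime := ⟨hp⟩
  -- `J` need not be a `p`-group, but its image in the permutations of `X^I` is one.
  have hpg : IsPGroup p (fixedPointsPerm I J X).range := by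
    rintro ⟨_, j, rfl⟩
    obtain ⟨k, hk⟩ := hJI j.2
    refine ⟨k, Subtype.ext ?_⟩
    change fixedPointsPerm I J X j ^ p ^ k = 1
    rw [← map_pow]
    ext x
    rw [max_eq_left hp.one_le] at hk
    exact x.2 ⟨_, hk⟩
  refine (hpg.card_modEq_card_fixedPoints (fixedPoints I X.carrier)).trans ?_
  refine (congrArg (· % p) (Nat.card_congr ?_) : _)
  refine
    { toFun := fun x => ⟨x.1.1, fun j => congrArg Subtype.val (x.2 ⟨_, j, rfl⟩)⟩
      invFun := fun x => ⟨⟨x.1, fun i => x.2 ⟨i, hIJ i.2⟩⟩, ?_⟩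
      left_inv := fun _ => rfl
      right_inv := fun _ => rfl }
  rintro ⟨_, j, rfl⟩
  exact Subtype.ext (x.2 j)

theorem markMod_eq_of_le {H : Type u} [CommGroup H] {p : ℕ} (hp : p.Prime ∨ p = 0)
    {I J : Subgroup H} (hIJ : I ≤ J) (hJI : J ≤ powerSaturation p I) (a : BurnsideRing H) :
    markMod p I a = markMod p J a := by
  rcases hp with hp | rfl
  · suffices h : (markMod p I).toAddMonoidHom = (markMod p J).toAddMonoidHom from
      DFunLike.congr_fun h a
    refine BurnsideRing.addHom_ext fun X => ?_
    change ((mark I (burnsideOf H X.cls) : ℤ) : ZMod p) = (mark J (burnsideOf H X.cls) : ℤ)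
    rw [mark_of, mark_of, Int.cast_natCast, Int.cast_natCast, ZMod.natCast_eq_natCast_iff]
    exact card_fixedPoints_modEq hp hIJ hJI X
  · rw [powerSaturation_zero] at hJI
    rw [le_antisymm hIJ hJI]

/-- Both marks are compared with the mark at `I ⊔ J`, which lies in both saturations. -/
theorem markMod_eq {H : Type u} [CommGroup H] {p : ℕ} (hp : p.Prime ∨ p = 0)
    {I J : Subgroup H} (hIJ : I ≤ powerSaturation p J) (hJI : J ≤ powerSaturation p I)
    (a : BurnsideRing H) : markMod p I a = markMod p J a :=
  (markMod_eq_of_le hp le_sup_left (sup_le (le_powerSaturation p I) hJI) a).trans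
    (markMod_eq_of_le hp le_sup_right (sup_le hIJ (le_powerSaturation p J)) a).symm

theorem dvd_of_markMod_natCast {H : Type u} [Group H] {p q : ℕ} {J : Subgroup H}
    (h : markMod q J (p : BurnsideRing H) = 0) : q ∣ p := by
  rwa [map_natCast, ZMod.natCast_eq_zero_iff] at h

theorem markMod_natCast_self {H : Type u} [Group H] (p : ℕ) (I : Subgroup H) :
    markMod p I (p : BurnsideRing H) = 0 := by
  rw [map_natCast, ZMod.natCast_self]

theorem markMod_eq_zero_of_dvd {H : Type u} [Group H] {p q : ℕ} (hqp : q ∣ p) {I : Subgroup H}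
    {a : BurnsideRing H} (h : markMod p I a = 0) : markMod q I a = 0 := by
  rw [markMod_apply, ZMod.intCast_zmod_eq_zero_iff_dvd] at h ⊢
  exact (Int.natCast_dvd_natCast.mpr hqp).trans h

/-- Two elements of the smaller kernel suffice as tests: the integer `p` and the separator of `I`.
-/
theorem ker_markMod_le {H : Type u} [CommGroup H] [Finite H] {p q : ℕ} (hq : q.Prime ∨ q = 0)
    {I J : Subgroup H} (h : RingHom.ker (markMod p I) ≤ RingHom.ker (markMod q J)) :
    q ∣ p ∧ J ≤ powerSaturation q I := by
  refine ⟨dvd_of_markMod_natCast (h (markMod_natCast_self p I)),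
    le_of_markMod_separator hq (h ?_)⟩
  rw [RingHom.mem_ker, markMod_apply, mark_separator q (le_powerSaturation q I), Int.cast_zero]

theorem ker_markMod_eq_iff {H : Type u} [CommGroup H] [Finite H] {p q : ℕ}
    (hp : p.Prime ∨ p = 0) (hq : q.Prime ∨ q = 0) {I J : Subgroup H} :
    RingHom.ker (markMod p I) = RingHom.ker (markMod q J) ↔
      p = q ∧ I ≤ powerSaturation p J ∧ J ≤ powerSaturation p I := by
  constructor
  · intro h
    obtain ⟨h1, h2⟩ := ker_markMod_le hq h.le
    obtain ⟨h3, h4⟩ := ker_markMod_le hp h.ge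
    obtain rfl := Nat.dvd_antisymm h3 h1
    exact ⟨rfl, h4, h2⟩
  · rintro ⟨rfl, h1, h2⟩
    ext a
    rw [RingHom.mem_ker, RingHom.mem_ker, markMod_eq hp h1 h2]

/-! ### Injectivity of the marks and the prime ideals of the Burnside ring. -/

/-- The complement of an orbit. -/
def FinGSet.deleteOrbit {H : Type u} [Group H] (X : FinGSet H) (x : X.carrier) : FinGSet H where
  carrier := {y : X.carrier // y ∉ orbit H x}
  action :=
    { smul := fun h y => ⟨h • y.1, fun hy => y.2 (by
        obtain ⟨g, hg⟩ := hy
        exact ⟨h⁻¹ * g, (mul_smul h⁻¹ g x).trans (inv_smul_eq_iff.mpr hg)⟩)⟩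
      one_smul := fun y => Subtype.ext (one_smul H y.1)
      mul_smul := fun g h y => Subtype.ext (mul_smul g h y.1) }

theorem FinGSet.cls_deleteOrbit {H : Type u} [Group H] [Finite H] (X : FinGSet H)
    (x : X.carrier) :
    X.cls = (FinGSet.quot (stabilizer H x)).cls + (X.deleteOrbit x).cls := by
  refine FinGSet.cls_eq_add (W₁ := FinGSet.quot (stabilizer H x)) (W₂ := X.deleteOrbit x)
    (ofQuotientStabilizer H x) Subtype.val (fun h q => ?_) (fun _ _ => rfl) ⟨?_, ?_⟩
  · exact ofQuotientStabilizer_smul H x h q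
  · rintro (q | y) (r | z) h
    · exact congrArg Sum.inl (injective_ofQuotientStabilizer H x h)
    · exact (z.2 (by rw [← show _ = z.1 from h]; exact ofQuotientStabilizer_mem_orbit H x q)).elim
    · exact (y.2 (by rw [show y.1 = _ from h]; exact ofQuotientStabilizer_mem_orbit H x r)).elim
    · exact congrArg Sum.inr (Subtype.ext h)
  · intro y
    by_cases hy : y ∈ orbit H x
    · obtain ⟨g, rfl⟩ := hy
      exact ⟨Sum.inl (QuotientGroup.mk g), rfl⟩
    · exact ⟨Sum.inr ⟨y, hy⟩, rfl⟩

theorem FinGSet.card_deleteOrbit_lt {H : Type u} [Group H] (X : FinGSet H) (x : X.carrier) :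
    Nat.card (X.deleteOrbit x).carrier < Nat.card X.carrier :=
  Finite.card_subtype_lt (x := x) fun h => h (mem_orbit_self x)

/-- Equal marks make each point stabilizer of one set lie below a stabilizer in the other. Starting
from a maximal stabilizer and going back and forth forces an equality. Both sets then contain the
same orbit, which is removed; the induction is on the total number of points. -/
theorem FinGSet.cls_eq_of_mark_eq {H : Type u} [Group H] [Finite H] (n : ℕ) :
    ∀ X Y : FinGSet H, Nat.card X.carrier + Nat.card Y.carrier < n →
      (∀ I : Subgroup H, mark I (burnsideOf H X.cls) = mark I (burnsideOf H Y.cls)) →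
      X.cls = Y.cls := by
  induction n with
  | zero => exact fun X Y h => (Nat.not_lt_zero _ h).elim
  | succ n ih =>
    intro X Y hn hXY
    have hfix : ∀ I : Subgroup H, Nat.card (fixedPoints I X.carrier) =
        Nat.card (fixedPoints I Y.carrier) := fun I => by
      have := hXY I
      rwa [mark_of, mark_of, Nat.cast_inj] at this
    have hmem : ∀ (Z : FinGSet H) (z : Z.carrier) (I : Subgroup H),
        z ∈ fixedPoints I Z.carrier ↔ I ≤ stabilizer H z := fun Z z I =>
      ⟨fun h i hi => h ⟨i, hi⟩, fun h i => h i.2⟩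
    have hexists : ∀ Z W : FinGSet H, (∀ I : Subgroup H, Nat.card (fixedPoints I Z.carrier) =
        Nat.card (fixedPoints I W.carrier)) → ∀ z : Z.carrier, ∃ w : W.carrier,
        stabilizer H z ≤ stabilizer H w := by
      intro Z W h z
      have h1 : Nonempty (fixedPoints (stabilizer H z) Z.carrier) :=
        ⟨⟨z, (hmem Z z _).mpr le_rfl⟩⟩
      have h2 := Nat.card_pos (α := fixedPoints (stabilizer H z) Z.carrier)
      rw [h] at h2
      obtain ⟨⟨w, hw⟩⟩ := (Nat.card_pos_iff.mp h2).1
      exact ⟨w, (hmem W w _).mp hw⟩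
    rcases isEmpty_or_nonempty X.carrier with hX | ⟨⟨x₀⟩⟩
    · have hY : IsEmpty Y.carrier :=
        ⟨fun y => hX.elim (hexists Y X (fun I => (hfix I).symm) y).choose⟩
      exact FinGSet.Iso.cls_eq ⟨Equiv.equivOfIsEmpty _ _, fun _ x => hX.elim x⟩
    · obtain ⟨_, ⟨x, rfl⟩, hx⟩ := (Set.toFinite (Set.range fun x : X.carrier =>
        stabilizer H x)).exists_maximal ⟨_, x₀, rfl⟩
      obtain ⟨y, hy⟩ := hexists X Y hfix x
      obtain ⟨x', hx'⟩ := hexists Y X (fun I => (hfix I).symm) y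
      have hxy : stabilizer H x = stabilizer H y :=
        le_antisymm hy (hx'.trans (hx ⟨x', rfl⟩ (hy.trans hx')))
      have h1 := X.cls_deleteOrbit x
      have h2 := Y.cls_deleteOrbit y
      rw [h1, h2, hxy]
      congr 1
      have hlt1 := X.card_deleteOrbit_lt x
      have hlt2 := Y.card_deleteOrbit_lt y
      refine ih _ _ (by omega) fun I => ?_
      have := hXY I
      rw [h1, h2, hxy] at this
      simp only [map_add] at this
      exact add_left_cancel this

theorem eq_zero_of_mark_eq_zero {H : Type u} [Group H] [Finite H] {a : BurnsideRing H}
    (h : ∀ I : Subgroup H, mark I a = 0) : a = 0 := by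
  obtain ⟨X, Y, rfl⟩ := BurnsideRing.exists_eq_sub a
  rw [sub_eq_zero]
  refine congrArg _ (FinGSet.cls_eq_of_mark_eq _ X Y (Nat.lt_succ_self _) fun I => ?_)
  have := h I
  rwa [map_sub, sub_eq_zero] at this

/-- The finitely many kernels of integral marks intersect in zero, so a prime contains one of them.
Modulo that kernel every element is an integer, and `P` is determined by the characteristic of its
residue ring. -/
theorem exists_eq_ker_markMod {H : Type u} [Group H] [Finite H] (P : Ideal (BurnsideRing H))
    [hP : P.IsPrime] : ∃ (I : Subgroup H) (p : ℕ), (p.Prime ∨ p = 0) ∧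
      P = RingHom.ker (markMod p I) := by
  have : Fintype (Subgroup H) := Fintype.ofFinite _
  obtain ⟨I, -, hI⟩ := (hP.inf_le' (s := Finset.univ)
    (f := fun I : Subgroup H => RingHom.ker (mark I))).mp (fun a ha => by
      rw [Submodule.mem_finsetInf] at ha
      rw [eq_zero_of_mark_eq_zero fun I => ha I (Finset.mem_univ I)]
      exact P.zero_mem)
  obtain ⟨p, hp⟩ := CharP.exists (BurnsideRing H ⧸ P)
  refine ⟨I, p, CharP.char_is_prime_or_zero (BurnsideRing H ⧸ P) p, Ideal.ext fun a => ?_⟩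
  have h1 : a - ((mark I a : ℤ) : BurnsideRing H) ∈ P :=
    hI (by rw [RingHom.mem_ker, map_sub, map_intCast, Int.cast_id, sub_self])
  have h2 : a ∈ P ↔ ((mark I a : ℤ) : BurnsideRing H) ∈ P := by
    constructor
    · intro h
      simpa using P.sub_mem h h1
    · intro h
      simpa using P.add_mem h1 h
  rw [h2, RingHom.mem_ker, markMod_apply, ZMod.intCast_zmod_eq_zero_iff_dvd,
    ← CharP.intCast_eq_zero_iff (BurnsideRing H ⧸ P) p, ← Ideal.Quotient.eq_zero_iff_mem,
    map_intCast]

theorem ker_markMod_isPrime {H : Type u} [Group H] {p : ℕ} (hp : p.Prime ∨ p = 0)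
    (I : Subgroup H) : (RingHom.ker (markMod p I)).IsPrime := by
  have : IsDomain (ZMod p) := by
    rcases hp with hp | rfl
    · have : Fact p.Prime := ⟨hp⟩
      infer_instance
    · exact inferInstanceAs (IsDomain ℤ)
  exact RingHom.ker_isPrime _

/-! ### The ideals `𝔭_{C,p}` and their primality. -/

theorem conjSubgroup_eq {G : Type u} [CommGroup G] (g : G) (H : Subgroup G) :
    conjSubgroup g H = H := by
  ext x
  change g * x * g⁻¹ ∈ H ↔ x ∈ H
  rw [mul_comm g, mul_inv_cancel_right]

theorem mem_markIdeal {G : Type u} [CommGroup G] {C : Subgroup G} {p : ℕ} {H : Subgroup G}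
    {a : BurnsideRing H} : a ∈ markIdeal C p H ↔
      ∀ I : Subgroup H, I.map H.subtype ≤ C → markMod p I a = 0 := by
  simp only [markIdeal, Submodule.mem_iInf, RingHom.mem_ker]
  refine forall_congr' fun I => ?_
  simp only [conjSubgroup_eq, exists_const]

theorem mark_normLe {G : Type u} [CommGroup G] [Finite G] {K H : Subgroup G} (h : K ≤ H)
    (I : Subgroup H) (a : BurnsideRing K) : mark I (normLe h a) =
      mark (I.comap (Subgroup.inclusion h)) a ^ ((Subgroup.inclusion h).range ⊔ I).index :=
  mark_norm (Subgroup.inclusion h) I a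

/-- The exponent is a positive index, so the correction term in the norm axiom is invisible to
marks. -/
theorem mark_normLe_zero {G : Type u} [CommGroup G] [Finite G] {K H : Subgroup G} (h : K ≤ H)
    (I : Subgroup H) : mark I (normLe h 0) = 0 := by
  rw [mark_normLe, map_zero, zero_pow Subgroup.index_ne_zero_of_finite]

theorem map_subtype_comap_inclusion_le {G : Type u} [Group G] {K H C : Subgroup G} (h : K ≤ H)
    {I : Subgroup H} (hI : I.map H.subtype ≤ C) :
    (I.comap (Subgroup.inclusion h)).map K.subtype ≤ C := by
  rintro _ ⟨k, hk, rfl⟩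
  exact hI ⟨_, hk, rfl⟩

/-- The ideal `𝔭_{C,p}` of the Burnside Tambara functor of a finite abelian group. -/
def markTambaraIdeal {G : Type u} [CommGroup G] [Finite G] (C : Subgroup G) (p : ℕ) :
    TambaraIdeal G where
  level := markIdeal C p
  res_mem {K H} h a ha := by
    rw [mem_markIdeal] at ha ⊢
    intro I hI
    refine (markMod_res (Subgroup.inclusion h) p I a).trans (ha _ ?_)
    rwa [Subgroup.map_map]
  tr_mem {K H} h a ha := by
    rw [mem_markIdeal] at ha ⊢
    intro I hI
    have h1 := ha _ (map_subtype_comap_inclusion_le h hI)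
    rw [markMod_apply] at h1 ⊢
    by_cases hIK : I ≤ (Subgroup.inclusion h).range
    · refine (congrArg Int.cast (mark_tr_of_le (Subgroup.inclusion_injective h) hIK a)).trans ?_
      rw [Int.cast_mul, h1, mul_zero]
    · exact (congrArg Int.cast (mark_tr_of_not_le hIK a)).trans Int.cast_zero
  norm_mem {K H} h a ha := by
    refine ⟨normLe h a - normLe h 0, ?_, (sub_add_cancel _ _).symm⟩
    rw [mem_markIdeal] at ha ⊢
    intro I hI
    have h1 := ha _ (map_subtype_comap_inclusion_le h hI)
    rw [markMod_apply] at h1 ⊢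
    rw [map_sub, mark_normLe_zero, sub_zero, mark_normLe, Int.cast_pow, h1,
      zero_pow Subgroup.index_ne_zero_of_finite]
  conj_mem g H a ha := by
    rw [mem_markIdeal] at ha ⊢
    intro I hI
    refine (markMod_res _ p I a).trans (ha _ ?_)
    rintro _ ⟨_, ⟨x, hx, rfl⟩, rfl⟩
    have h1 : g * (x : G) * g⁻¹ = x := by rw [mul_comm g, mul_inv_cancel_right]
    change g * (x : G) * g⁻¹ ∈ C
    rw [h1]
    exact hI ⟨x, hx, rfl⟩

/-- An element with nonzero mark at some `L ≤ H ∩ C` is restricted to `L` and normed up to `C`. At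
the whole group `C` the exponent in the norm formula is one, so the mark survives unchanged. This
moves all witnesses to a common level and subgroup, where they can be multiplied. -/
theorem exists_mem_level_markMod_ne_zero {G : Type u} [CommGroup G] [Finite G] {C : Subgroup G}
    {p : ℕ} {I : TambaraIdeal G} (hI : ¬ I ≤ markTambaraIdeal C p) :
    ∃ a ∈ I.level C, markMod p ⊤ a ≠ 0 := by
  obtain ⟨H, hH⟩ := not_forall.mp hI
  obtain ⟨a, ha, haC⟩ := Set.not_subset.mp hH
  have h1 : ¬ ∀ L : Subgroup H, L.map H.subtype ≤ C → markMod p L a = 0 :=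
    fun h => haC (mem_markIdeal.mpr h)
  push Not at h1
  obtain ⟨L, hL, hne⟩ := h1
  have hLH : L.map H.subtype ≤ H := Subgroup.map_subtype_le L
  have hmap : (⊤ : Subgroup (L.map H.subtype)).map (Subgroup.inclusion hLH) = L := by
    ext x
    constructor
    · rintro ⟨⟨_, y, hy, rfl⟩, -, rfl⟩
      exact hy
    · intro hx
      exact ⟨⟨x, x, hx, rfl⟩, trivial, rfl⟩
  obtain ⟨b, hb, hab⟩ := I.norm_mem hL (resLe hLH a) (I.res_mem hLH a ha)
  refine ⟨b, hb, fun h => hne ?_⟩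
  have h2 : mark ⊤ b = mark L a := by
    have h3 := congrArg (mark ⊤) hab
    rw [map_add, mark_normLe_zero, add_zero, mark_normLe, sup_top_eq, Subgroup.index_top, pow_one,
      Subgroup.comap_top] at h3
    rw [← h3]
    refine (mark_res (Subgroup.inclusion hLH) ⊤ a).trans ?_
    rw [hmap]
  rw [markMod_apply, ← h2]
  exact h

theorem markTambaraIdeal_isPrime {G : Type u} [CommGroup G] [Finite G] (C : Subgroup G)
    {p : ℕ} (hp : p.Prime ∨ p = 0) : (markTambaraIdeal C p).IsPrime := by
  constructor
  · refine ⟨⊥, fun h => ?_⟩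
    have h1 : (1 : BurnsideRing (⊥ : Subgroup G)) ∈ markIdeal C p ⊥ :=
      (Ideal.eq_top_iff_one _).mp h
    have h2 := mem_markIdeal.mp h1 ⊥ (by simp)
    exact (ker_markMod_isPrime hp (⊥ : Subgroup (⊥ : Subgroup G))).one_notMem h2
  · intro I J hIJ
    by_contra! h
    obtain ⟨a, ha, hane⟩ := exists_mem_level_markMod_ne_zero h.1
    obtain ⟨b, hb, hbne⟩ := exists_mem_level_markMod_ne_zero h.2
    -- The product ideal consists of transfers, so `a * b` enters through the transfer along `C ≤
    -- C`, which has index one and keeps the mark.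
    have h1 : ∑ _i : Fin 1, trLe (le_refl C) (a * b) ∈ markIdeal C p C :=
      hIJ C ⟨1, fun _ => C, fun _ => le_rfl, fun _ => a, fun _ => b, fun _ => ha, fun _ => hb, rfl⟩
    rw [Fin.sum_const, one_smul] at h1
    have h2 := mem_markIdeal.mp h1 ⊤ (Subgroup.map_subtype_le ⊤)
    have hr : (Subgroup.inclusion (le_refl C)).range = ⊤ :=
      MonoidHom.range_eq_top.mpr fun x => ⟨x, rfl⟩
    have h3 : mark ⊤ (trLe (le_refl C) (a * b)) = mark ⊤ (a * b) := by
      refine (mark_tr_of_le (Subgroup.inclusion_injective _) hr.ge (a * b)).trans ?_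
      rw [hr, Subgroup.index_top, Nat.cast_one, one_mul, Subgroup.comap_top]
    rw [markMod_apply, h3] at h2
    rcases (ker_markMod_isPrime hp (⊤ : Subgroup C)).mem_or_mem (x := a) (y := b) h2 with h | h
    · exact hane h
    · exact hbne h

/-- The prime ideal `𝔭_{C,p}` as a point of the spectrum. -/
def markPrime {G : Type u} [CommGroup G] [Finite G] (C : Subgroup G) {p : ℕ}
    (hp : p.Prime ∨ p = 0) : markPrimes G :=
  ⟨⟨markTambaraIdeal C p, markTambaraIdeal_isPrime C hp⟩, C, p, hp, rfl⟩

theorem exists_eq_markPrime {G : Type u} [CommGroup G] [Finite G] (P : markPrimes G) :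
    ∃ (C : Subgroup G) (p : ℕ) (hp : p.Prime ∨ p = 0), P = markPrime C hp := by
  obtain ⟨P, C, p, hp, h⟩ := P
  exact ⟨C, p, hp, Subtype.ext (TambaraSpec.ext (TambaraIdeal.ext h))⟩

/-! ### Inclusions among the `𝔭_{C,p}` and the bijection with the primes of `A(G)`. -/

theorem markIdeal_le_iff {G : Type u} [CommGroup G] [Finite G] {C D : Subgroup G} {p q : ℕ}
    (hq : q.Prime ∨ q = 0) :
    markIdeal C p ≤ markIdeal D q ↔ q ∣ p ∧ D ≤ powerSaturation q C := by
  constructor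
  · intro h
    have h1 : ∀ a ∈ markIdeal C p D, markMod q ⊤ a = 0 := fun a ha =>
      mem_markIdeal.mp (h D ha) ⊤ (Subgroup.map_subtype_le ⊤)
    constructor
    · exact dvd_of_markMod_natCast (h1 _ (mem_markIdeal.mpr fun I _ => markMod_natCast_self p I))
    -- The separator of `C ∩ D` at level `D` has zero mark at every subgroup of `C ∩ D`, so it
    -- belongs to `𝔭_{C,p}` and hence to `𝔭_{D,q}`.
    · have h2 : ⊤ ≤ powerSaturation q (C.subgroupOf D) := by
        refine le_of_markMod_separator hq (h1 _ (mem_markIdeal.mpr fun I hI => ?_))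
        rw [markMod_apply, mark_separator, Int.cast_zero]
        refine le_trans ?_ (le_powerSaturation q _)
        exact Subgroup.map_le_iff_le_comap.mp hI
      intro x hx
      obtain ⟨k, hk⟩ := h2 (Subgroup.mem_top ⟨x, hx⟩)
      exact ⟨k, hk⟩
  · rintro ⟨hqp, hDC⟩ H a ha
    refine mem_markIdeal.mpr fun I hI => ?_
    -- Every element of `I` has a `q`-power in `I ∩ C`, so `I` and `I ∩ C` have the same marks
    -- modulo `q`, and the latter subgroup is seen by `𝔭_{C,p}`.
    have h1 : I ⊓ C.subgroupOf H ≤ I := inf_le_left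
    rw [← markMod_eq_of_le hq h1]
    · refine markMod_eq_zero_of_dvd hqp (mem_markIdeal.mp ha _ ?_)
      exact Subgroup.map_le_iff_le_comap.mpr inf_le_right
    · intro x hx
      obtain ⟨k, hk⟩ := hDC (hI ⟨x, hx, rfl⟩)
      exact ⟨k, I.pow_mem hx _, hk⟩

theorem markPrime_le_iff {G : Type u} [CommGroup G] [Finite G] {C D : Subgroup G} {p q : ℕ}
    (hp : p.Prime ∨ p = 0) (hq : q.Prime ∨ q = 0) :
    markPrime C hp ≤ markPrime D hq ↔ q ∣ p ∧ D ≤ powerSaturation q C :=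
  markIdeal_le_iff hq

theorem markIdeal_eq_iff {G : Type u} [CommGroup G] [Finite G] {C D : Subgroup G} {p q : ℕ}
    (hp : p.Prime ∨ p = 0) (hq : q.Prime ∨ q = 0) :
    markIdeal C p = markIdeal D q ↔ p = q ∧ C ≤ powerSaturation p D ∧ D ≤ powerSaturation p C := by
  rw [le_antisymm_iff, markIdeal_le_iff hq, markIdeal_le_iff hp]
  constructor
  · rintro ⟨⟨h1, h2⟩, h3, h4⟩
    obtain rfl := Nat.dvd_antisymm h3 h1
    exact ⟨rfl, h4, h2⟩
  · rintro ⟨rfl, h1, h2⟩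
    exact ⟨⟨dvd_rfl, h2⟩, dvd_rfl, h1⟩

theorem ker_markMod_eq_iff_markIdeal_eq {G : Type u} [CommGroup G] [Finite G] {C D : Subgroup G}
    {p q : ℕ} (hp : p.Prime ∨ p = 0) (hq : q.Prime ∨ q = 0) :
    RingHom.ker (markMod p C) = RingHom.ker (markMod q D) ↔ markIdeal C p = markIdeal D q := by
  rw [ker_markMod_eq_iff hp hq, markIdeal_eq_iff hp hq]

/-- A prime may be presented by several subgroups `C`. An arbitrary choice works because the two
families have the same coincidences, which gives independence of the choice and injectivity alike.
-/
theorem exists_equiv_markPrimes (G : Type u) [CommGroup G] [Finite G] :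
    ∃ e : PrimeSpectrum (BurnsideRing G) ≃ markPrimes G,
      ∀ (C : Subgroup G) (p : ℕ), (p.Prime ∨ p = 0) → ∀ P : PrimeSpectrum (BurnsideRing G),
        P.asIdeal = RingHom.ker (markMod p C) ↔ (e P).1.ideal.level = markIdeal C p := by
  choose C p hp hP using fun P : PrimeSpectrum (BurnsideRing G) =>
    exists_eq_ker_markMod P.asIdeal
  refine ⟨Equiv.ofBijective (fun P => markPrime (C P) (hp P)) ⟨fun P Q h => ?_, fun Q => ?_⟩,
    fun D q hq P => ?_⟩
  · refine PrimeSpectrum.ext ?_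
    rw [hP P, hP Q, ker_markMod_eq_iff_markIdeal_eq (hp P) (hp Q)]
    exact congrArg (fun Q : markPrimes G => Q.1.ideal.level) h
  · obtain ⟨D, q, hq, rfl⟩ := exists_eq_markPrime Q
    let P : PrimeSpectrum (BurnsideRing G) := ⟨_, ker_markMod_isPrime hq D⟩
    refine ⟨P, Subtype.ext (TambaraSpec.ext (TambaraIdeal.ext ?_))⟩
    exact (ker_markMod_eq_iff_markIdeal_eq (hp P) hq).mp (hP P).symm
  · rw [hP P]
    exact ker_markMod_eq_iff_markIdeal_eq (hp P) hq

/-! ### Krull dimensions. -/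

/-- Kernels of characteristic `p > 0` are maximal, since the residue ring is the field `ℤ/p`.
Kernels of integral marks are minimal. -/
theorem ringKrullDim_burnsideRing (G : Type u) [CommGroup G] [Finite G] :
    ringKrullDim (BurnsideRing G) = 1 := by
  refine le_antisymm (Order.krullDim_le_one_iff.mpr fun P => ?_) (Order.one_le_krullDim_iff.mpr ?_)
  · obtain ⟨I, p, hp, hP⟩ := exists_eq_ker_markMod P.asIdeal
    have hle : ∀ Q R : PrimeSpectrum (BurnsideRing G), Q ≤ R ↔ Q.asIdeal ≤ R.asIdeal :=
      fun _ _ => Iff.rfl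
    rcases hp with hp | rfl
    · refine Or.inr fun Q hQ => ?_
      obtain ⟨J, q, hq, hQ'⟩ := exists_eq_ker_markMod Q.asIdeal
      rw [hle, hP, hQ'] at hQ ⊢
      have : Fact p.Prime := ⟨hp⟩
      have hmax : (RingHom.ker (markMod p I)).IsMaximal :=
        RingHom.ker_isMaximal_of_surjective _ (ZMod.ringHom_surjective _)
      exact (hmax.eq_of_le (ker_markMod_isPrime hq J).ne_top hQ).ge
    · refine Or.inl fun Q hQ => ?_
      obtain ⟨J, q, hq, hQ'⟩ := exists_eq_ker_markMod Q.asIdeal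
      rw [hle, hP, hQ'] at hQ ⊢
      obtain rfl := zero_dvd_iff.mp (ker_markMod_le (Or.inr rfl) hQ).1
      intro a ha
      -- This difference lies in the smaller prime, hence in the larger one, so for `a` in the
      -- larger prime the integer `mark J a` vanishes.
      have h1 : a - ((mark J a : ℤ) : BurnsideRing G) ∈ RingHom.ker (markMod 0 J) := by
        rw [RingHom.mem_ker, markMod_apply, map_sub, map_intCast, Int.cast_id, sub_self,
          Int.cast_zero]
      have h2 := hQ h1
      rw [RingHom.mem_ker, map_sub, (RingHom.mem_ker).mp ha, zero_sub, neg_eq_zero,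
        map_intCast] at h2
      exact h2
  · refine ⟨⟨_, ker_markMod_isPrime (Or.inr rfl) ⊥⟩,
      ⟨_, ker_markMod_isPrime (Or.inl Nat.prime_two) ⊥⟩, lt_of_le_not_ge ?_ ?_⟩
    · intro a ha
      exact markMod_eq_zero_of_dvd (dvd_zero 2) ha
    · intro h
      have h1 := (ker_markMod_le (p := 2) (Or.inr rfl) h).1
      exact absurd (zero_dvd_iff.mp h1) two_ne_zero

/-- The elements of `C` of order prime to `p`; for `p = 0` this is `C` itself. -/
def primeToPart {G : Type u} [CommGroup G] (p : ℕ) (C : Subgroup G) : Subgroup G where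
  carrier := {x | x ∈ C ∧ (orderOf x).Coprime (max p 1)}
  one_mem' := ⟨C.one_mem, by simp⟩
  mul_mem' := by
    rintro x y ⟨hx, hx'⟩ ⟨hy, hy'⟩
    exact ⟨C.mul_mem hx hy, Nat.Coprime.coprime_dvd_left
      ((Commute.all x y).orderOf_mul_dvd_mul_orderOf) (hx'.mul_left hy')⟩
  inv_mem' := by
    rintro x ⟨hx, hx'⟩
    exact ⟨C.inv_mem hx, by rwa [orderOf_inv]⟩

theorem primeToPart_le {G : Type u} [CommGroup G] (p : ℕ) (C : Subgroup G) :
    primeToPart p C ≤ C := fun _ h => h.1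

theorem primeToPart_zero {G : Type u} [CommGroup G] (C : Subgroup G) : primeToPart 0 C = C :=
  le_antisymm (primeToPart_le 0 C) fun x hx => ⟨hx, by simp⟩

/-- An element of order prime to `p` is a power of each of its `p`-power powers. Prime-to-`p` parts
thus turn the saturation preorder into plain inclusion. -/
theorem primeToPart_le_of_le_powerSaturation {G : Type u} [CommGroup G] {p : ℕ}
    {C D : Subgroup G} (h : D ≤ powerSaturation p C) : primeToPart p D ≤ primeToPart p C := by
  rintro x ⟨hx, hx'⟩
  obtain ⟨k, hk⟩ := h hx
  refine ⟨?_, hx'⟩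
  obtain ⟨m, hm⟩ := exists_pow_eq_self_of_coprime (hx'.symm.pow_left k)
  rw [← hm]
  exact C.pow_mem hk m

theorem le_powerSaturation_primeToPart {G : Type u} [CommGroup G] [Finite G] {p : ℕ}
    (hp : p.Prime ∨ p = 0) (C : Subgroup G) : C ≤ powerSaturation p (primeToPart p C) := by
  rcases hp with hp | rfl
  · intro x hx
    obtain ⟨k, m, hm, hkm⟩ := Nat.exists_eq_pow_mul_and_not_dvd (orderOf_pos x).ne' p hp.ne_one
    refine ⟨k, C.pow_mem hx _, ?_⟩
    rw [max_eq_left hp.one_le, orderOf_pow_of_dvd (pow_ne_zero k hp.ne_zero) ⟨m, hkm⟩, hkm,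
      Nat.mul_div_cancel_left _ (pow_pos hp.pos k)]
    exact ((Nat.Prime.coprime_iff_not_dvd hp).mpr hm).symm
  · rw [primeToPart_zero]
    exact le_powerSaturation 0 C

/-- The upper bound comes from a strictly increasing rank function, the lower bound from the
reversed subgroup lattice in characteristic zero with one point of characteristic two on top. -/
theorem krullDim_markPrimes (G : Type u) [CommGroup G] [Finite G] :
    Order.krullDim (markPrimes G) = Order.krullDim (Subgroup G) + 1 := by
  apply le_antisymm
  · choose C p hp hP using exists_eq_markPrime (G := G)
    -- Primes grow as subgroups shrink, so the height is taken in the order dual. The extra unit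
    -- pays for the single possible change of characteristic.
    let r : markPrimes G → ℕ∞ := fun P =>
      Order.height (OrderDual.toDual (primeToPart (p P) (C P))) + if p P = 0 then 0 else 1
    have hr : ∀ P Q, P < Q → r P + 1 ≤ r Q := by
      intro P Q hPQ
      have hle := hPQ.le
      have hnle := hPQ.not_ge
      rw [hP P, hP Q, markPrime_le_iff] at hle hnle
      have hpart := primeToPart_le_of_le_powerSaturation hle.2
      by_cases h : p P = p Q
      -- With the characteristic fixed, equal prime-to-`p` parts would give the reverse inclusion of
      -- ideals.
      · have hlt : primeToPart (p Q) (C Q) < primeToPart (p P) (C P) := by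
          rw [h]
          refine lt_of_le_of_ne hpart fun heq => hnle ⟨h.dvd, ?_⟩
          refine (le_powerSaturation_primeToPart (hp P) (C P)).trans
            (powerSaturation_mono _ ?_)
          rw [h, ← heq]
          exact primeToPart_le _ _
        change _ + (if p P = 0 then 0 else 1) + 1 ≤ _ + if p Q = 0 then 0 else 1
        rw [h, add_right_comm]
        exact add_le_add_left (Order.height_add_one_le (OrderDual.toDual_lt_toDual.mpr
          (h ▸ hlt))) _
      · have hQ0 : p Q ≠ 0 := fun h0 => h (by
          have h3 := hle.1
          rw [h0, zero_dvd_iff] at h3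
          rw [h0, h3])
        have hP0 : p P = 0 := (hp P).resolve_left fun h0 =>
          h ((Nat.prime_dvd_prime_iff_eq ((hp Q).resolve_right hQ0) h0).mp hle.1).symm
        change _ + (if p P = 0 then 0 else 1) + 1 ≤ _ + if p Q = 0 then 0 else 1
        rw [if_pos hP0, if_neg hQ0, add_zero]
        refine add_le_add_left (Order.height_mono (OrderDual.toDual_le_toDual.mpr ?_)) 1
        rw [hP0, primeToPart_zero]
        exact hpart.trans (primeToPart_le _ _)
    refine iSup_le fun s => ?_
    have hs : ∀ i : Fin (s.length + 1), ((i : ℕ) : ℕ∞) ≤ r (s i) := by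
      intro i
      induction i using Fin.induction with
      | zero => simp
      | succ i ih =>
        refine le_trans ?_ (hr _ _ (s.step i))
        rw [Fin.val_succ, Nat.cast_add, Nat.cast_one]
        exact add_le_add_left ih 1
    have h1 : ((s.length : ℕ∞) : WithBot ℕ∞) ≤ (r (s (Fin.last _)) : ℕ∞) :=
      WithBot.coe_le_coe.mpr (hs (Fin.last _))
    refine h1.trans ?_
    have h2 : r (s (Fin.last _)) ≤ Order.height (OrderDual.toDual
        (primeToPart (p (s (Fin.last _))) (C (s (Fin.last _))))) + 1 := by
      refine add_le_add_right ?_ _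
      split_ifs <;> simp
    refine (WithBot.coe_le_coe.mpr h2).trans ?_
    rw [WithBot.coe_add, ← Order.krullDim_orderDual (α := Subgroup G)]
    exact add_le_add_left (Order.height_le_krullDim _) 1
  · rw [← Order.krullDim_orderDual (α := Subgroup G), ← Order.krullDim_WithTop]
    -- The added top goes to `𝔭_{⊥,2}`, which contains every `𝔭_{C,0}`; any other prime number would
    -- serve as well.
    let f : WithTop (Subgroup G)ᵒᵈ → markPrimes G := fun C =>
      C.recTopCoe (markPrime ⊥ (Or.inl Nat.prime_two))
        (fun C => markPrime (OrderDual.ofDual C) (Or.inr rfl))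
    refine Order.krullDim_le_of_strictMono f fun C D hCD => ?_
    induction C with
    | top => exact (not_top_lt hCD).elim
    | coe C =>
      induction D with
      | top =>
        refine lt_of_le_not_ge
          ((markPrime_le_iff (Or.inr rfl) (Or.inl Nat.prime_two)).mpr ⟨dvd_zero 2, bot_le⟩) fun h => ?_
        exact two_ne_zero (zero_dvd_iff.mp
          ((markPrime_le_iff (Or.inl Nat.prime_two) (Or.inr rfl)).mp h).1)
      | coe D =>
        have h0 : C < D := WithTop.coe_lt_coe.mp hCD
        have h1 : OrderDual.ofDual D < OrderDual.ofDual C := OrderDual.ofDual_lt_ofDual.mpr h0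
        refine lt_of_le_not_ge
          ((markPrime_le_iff (Or.inr rfl) (Or.inr rfl)).mpr ⟨dvd_rfl, ?_⟩) fun h => ?_
        · rw [powerSaturation_zero]
          exact h1.le
        · have h2 := ((markPrime_le_iff (Or.inr rfl) (Or.inr rfl)).mp h).2
          rw [powerSaturation_zero] at h2
          exact h1.not_ge h2

/-! ### Specialization and the absence of a homeomorphism. -/

theorem markPrimes_specializes_iff {G : Type u} [CommGroup G] [Finite G] (P Q : markPrimes G) :
    P ⤳ Q ↔ P ≤ Q := by
  rw [← Topology.IsInducing.subtypeVal.specializes_iff, specializes_iff_forall_closed]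
  constructor
  · exact fun h => h (TambaraSpec.V P.1.ideal)
      ((TambaraSpec.isClosed_iff _).mpr ⟨P.1.ideal, rfl⟩) (le_refl P.1.ideal)
  · intro h Z hZ hP
    obtain ⟨I, rfl⟩ := (TambaraSpec.isClosed_iff Z).mp hZ
    exact le_trans (show I ≤ P.1.ideal from hP) h

/-- In both spaces inclusion of primes is specialization, so a homeomorphism would be an order
isomorphism and equate the dimensions. The chain `⊥ < ⊤` of subgroups makes one of them at least
two. -/
theorem isEmpty_homeomorph_markPrimes (G : Type u) [CommGroup G] [Finite G] [Nontrivial G] :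
    IsEmpty (PrimeSpectrum (BurnsideRing G) ≃ₜ markPrimes G) := by
  refine ⟨fun e => ?_⟩
  let f : PrimeSpectrum (BurnsideRing G) ≃o markPrimes G :=
    { e.toEquiv with
      map_rel_iff' := fun {P Q} => by
        rw [PrimeSpectrum.le_iff_specializes, ← markPrimes_specializes_iff]
        exact e.isInducing.specializes_iff }
  have h1 : ringKrullDim (BurnsideRing G) = Order.krullDim (markPrimes G) :=
    Order.krullDim_eq_of_orderIso f
  rw [ringKrullDim_burnsideRing, krullDim_markPrimes] at h1
  have h2 : (1 : WithBot ℕ∞) ≤ Order.krullDim (Subgroup G) :=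
    Order.one_le_krullDim_iff.mpr ⟨⊥, ⊤, bot_lt_top⟩
  have h3 : (1 : WithBot ℕ∞) + 1 ≤ 1 := (add_le_add_left h2 1).trans h1.ge
  exact absurd h3 (by decide)

end

end BurnsideTambara

theorem proposition3p9 (G : Type*) [CommGroup G] [Finite G] :
    (∀ (C : Subgroup G) (p : ℕ), (p.Prime ∨ p = 0) →
      ∃ P : BurnsideTambara.TambaraSpec G,
        P.ideal.level = BurnsideTambara.markIdeal C p) ∧
    (∃ e : PrimeSpectrum (BurnsideTambara.BurnsideRing G) ≃ BurnsideTambara.markPrimes G,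
      ∀ (C : Subgroup G) (p : ℕ), (p.Prime ∨ p = 0) →
        ∀ P : PrimeSpectrum (BurnsideTambara.BurnsideRing G),
          P.asIdeal = RingHom.ker (BurnsideTambara.markMod p C) ↔
            (e P).1.ideal.level = BurnsideTambara.markIdeal C p) ∧
    (Nontrivial G →
      IsEmpty (PrimeSpectrum (BurnsideTambara.BurnsideRing G) ≃ₜ BurnsideTambara.markPrimes G)) ∧
    ringKrullDim (BurnsideTambara.BurnsideRing G) = 1 ∧
    Order.krullDim (BurnsideTambara.markPrimes G) = Order.krullDim (Subgroup G) + 1 :=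
  ⟨fun C _ hp => ⟨(BurnsideTambara.markPrime C hp).1, rfl⟩,
    BurnsideTambara.exists_equiv_markPrimes G,
    fun _ => BurnsideTambara.isEmpty_homeomorph_markPrimes G,
    BurnsideTambara.ringKrullDim_burnsideRing G, BurnsideTambara.krullDim_markPrimes G⟩
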